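/- Let $(\mathcal R,\partial)$ be a commutative differential ring (with unit) with ring of constants $\mathcal C=\ker\partial$, and let $Q:\mathcal R\to\mathcal R$ be a quasi-integration, i.e. a $\mathcal C$-linear map with $\partial Q\partial=\partial$ and $Q\partial Q=Q$. Put $\mathcal R_J=Q\mathcal R$ and $\mathcal R_T=\ker Q$. All tensor products are over $\mathcal C$. Let $\mathcal T=\bigoplus_{n\ge0}\mathcal R_T^{\otimes n}$ with unit $1_{\mathcal T}$ (the empty tensor), and let $\mathbin{\sqcup\!\sqcup}$ be the shuffle product on $\mathcal T$: the $\mathcal C$-bilinear product with unit $1_{\mathcal T}$ and $(a\otimes t)\mathbin{\sqcup\!\sqcup}(b\otimes s)=a\otimes(t\mathbin{\sqcup\!\sqcup}(b\otimes s))+b\otimes((a\otimes t)\mathbin{\sqcup\!\sqcup}s)$ for $a,b\in\mathcal R_T$, $t,s\in\mathcal T$. Put $\widetilde{\mathcal T}=\bigoplus_{n\ge1}\mathcal R_T^{\otimes n}$. For a pure tensor $f=f_1\otimes\dots\otimes f_n$ write $f_i^j=f_i\otimes\dots\otimes f_j$, with $f_{j+1}^j=1_{\mathcal T}$. Let $\mathcal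 C_1=\mathrm{Sym}(\varepsilon(\mathcal R_J\otimes\mathcal T))$ and $\mathcal C_2=\mathrm{Sym}(\varepsilon(\widetilde{\mathcal T}^{\odot2}))/J_2$, where $\varepsilon$ denotes an isomorphism onto a copy of the module, $\widetilde{\mathcal T}^{\odot 2}$ is the symmetric square over $\mathcal C$, and $J_2$ is the ideal generated by $$\varepsilon((f\mathbin{\sqcup\!\sqcup}g)\odot h)-\varepsilon(f\odot(g\mathbin{\sqcup\!\sqcup}h))+\sum_{j=0}^{m-1}\Big(\sum_{i=\max(0,1-j)}^{n-1}\varepsilon(f_{i+1}^n\odot g_{j+1}^m)\,\varepsilon((f_1^i\mathbin{\sqcup\!\sqcup}g_1^j)\odot h)-\sum_{k=\max(0,1-j)}^{l-1}\varepsilon(f\odot(g_1^j\mathbin{\sqcup\!\sqcup}h_1^k))\,\varepsilon(g_{j+1}^m\odot h_{k+1}^l)\Big)$$ for all pure tensors $f,g,h$ of lengths $n,m,l\ge1$. Let $\mathcal C_2\otimes\mathcal T$ carry the commutative, associative, $\mathcal C_2$-bilinear product with unit $1\otimes 1_{\mathcal T}$ given for pure tensors $f,g$ of lengths $n,m\ge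 0$ by $$(c\otimes f)\cdot(d\otimes g)=cd\otimes(f\mathbin{\sqcup\!\sqcup}g)+\sum_{i=0}^{n-1}\sum_{j=0}^{m-1}\big(cd\,\varepsilon(f_{i+1}^n\odot g_{j+1}^m)\big)\otimes(f_1^i\mathbin{\sqcup\!\sqcup}g_1^j).$$ The algebra $\mathrm{IDR}(\mathcal R)=\mathcal R\otimes\mathcal C_1\otimes\mathcal C_2\otimes\mathcal T$ is the $\mathcal C$-tensor product of the commutative $\mathcal C$-algebras $\mathcal R$, $\mathcal C_1$ and $(\mathcal C_2\otimes\mathcal T,+,\cdot)$. An algebra basis is an algebraically independent generating set. (0) With $\mathcal T_n=\bigoplus_{i\le n}\mathcal R_T^{\otimes i}$, the submodules $(\mathcal C_2\otimes\mathcal T_n)_{n\in\mathbb N}$ form an exhaustive filtration of the $\mathcal C_2$-algebra $(\mathcal C_2\otimes\mathcal T,+,\cdot)$. Its $n$-th graded piece is identified with $\mathcal C_2\otimes\mathcal R_T^{\otimes n}$, and the associated graded algebra is $\mathcal C_2\otimes\mathcal T$ with the product $(c\otimes f)\mathbin{\sqcup\!\sqcup}(d\otimes g)=cd\otimes(f\mathbin{\sqcup\!\sqcup}g)$: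 for $x\in\mathcal C_2\otimes\mathcal R_T^{\otimes n}$ and $y\in\mathcal C_2\otimes\mathcal R_T^{\otimes m}$, one has $x\mathbin{\sqcup\!\sqcup}y\in\mathcal C_2\otimes\mathcal R_T^{\otimes(n+m)}$ and $x\cdot y-x\mathbin{\sqcup\!\sqcup}y\in\bigoplus_{i<n+m}\mathcal C_2\otimes\mathcal R_T^{\otimes i}$. Let $B\subseteq\mathcal T$ be a set of homogeneous elements. (1) If $B$ generates the $\mathcal C$-algebra $(\mathcal T,+,\mathbin{\sqcup\!\sqcup})$, then $\{1\otimes b\mid b\in B\}$ generates the $\mathcal C_2$-algebra $(\mathcal C_2\otimes\mathcal T,+,\cdot)$. (2) Assume that the $\mathcal C$-module $\mathcal C_2$ is semisimple or that the $\mathcal C$-subalgebra of $(\mathcal T,+,\mathbin{\sqcup\!\sqcup})$ generated by $B$ has a direct complement in the $\mathcal C$-module $\mathcal T$. If $B$ is algebraically independent in $(\mathcal T,+,\mathbin{\sqcup\!\sqcup})$ over $\mathcal C$, then $\{1\otimes b\mid b\in B\}$ is algebraically independent in $(\mathcal C_2\otimes\mathcal T,+,\cdot)$ over $\mathcal C_2$.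 (3) If $B$ is a $\mathcal C$-algebra basis of $(\mathcal T,+,\mathbin{\sqcup\!\sqcup})$, then $\{1\otimes1\otimes1\otimes b\mid b\in B\}$ is an algebra basis of $\mathrm{IDR}(\mathcal R)$ over its subring $\mathcal R\otimes\mathcal C_1\otimes\mathcal C_2\otimes\mathcal C1_{\mathcal T}$. -/

import Mathlib

open scoped TensorProduct

noncomputable section

namespace FreeIDR

section Shuffle

variable (K : Type*) [CommRing K] (M : Type*) [AddCommGroup M] [Module K M]

/-- The pure tensor `a₁ ⊗ ⋯ ⊗ aₙ` in the tensor algebra, for a list `[a₁, …, aₙ]`. -/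
def pureTensor {M : Type*} [AddCommGroup M] [Module K M] (l : List M) : TensorAlgebra K M :=
  (l.map (TensorAlgebra.ι K)).prod

@[simp] theorem pureTensor_nil : pureTensor K ([] : List M) = 1 := rfl

@[simp] theorem pureTensor_cons (a : M) (l : List M) :
    pureTensor K (a :: l) = TensorAlgebra.ι K a * pureTensor K l := by
  simp [pureTensor]

theorem mem_span_pureTensor (x : TensorAlgebra K M) :
    x ∈ Submodule.span K (Set.range (pureTensor K (M := M))) := by
  suffices h : ∀ s ∈ Submodule.span K (Set.range (pureTensor K (M := M))),
      x * s ∈ Submodule.span K (Set.range (pureTensor K (M := M))) by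
    simpa using h 1 (Submodule.subset_span ⟨[], rfl⟩)
  induction x using TensorAlgebra.induction with
  | algebraMap r =>
    intro s hs
    rw [← Algebra.smul_def]
    exact Submodule.smul_mem _ _ hs
  | ι a =>
    intro s hs
    induction hs using Submodule.span_induction with
    | mem x hx =>
      obtain ⟨l, rfl⟩ := hx
      exact Submodule.subset_span ⟨a :: l, by simp⟩
    | zero => simp
    | add x y _ _ hx hy => rw [mul_add]; exact Submodule.add_mem _ hx hy
    | smul r x _ hx => rw [mul_smul_comm]; exact Submodule.smul_mem _ _ hx
  | mul x y hx hy => intro s hs; rw [mul_assoc]; exact hx _ (hy _ hs)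
  | add x y hx hy => intro s hs; rw [add_mul]; exact Submodule.add_mem _ (hx _ hs) (hy _ hs)

variable {K M} in
theorem pureTensor_induction {P : TensorAlgebra K M → Prop} (pure : ∀ l, P (pureTensor K l))
    (zero : P 0) (add : ∀ x y, P x → P y → P (x + y)) (smul : ∀ (r : K) x, P x → P (r • x))
    (x : TensorAlgebra K M) : P x := by
  refine Submodule.span_induction (p := fun x _ => P x) ?_ zero (fun x y _ _ => add x y)
    (fun r x _ => smul r x) (mem_span_pureTensor K M x)
  rintro _ ⟨l, rfl⟩
  exact pure l

variable {K M} in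
theorem ext_pureTensor {N : Type*} [AddCommGroup N] [Module K N]
    {φ ψ : TensorAlgebra K M →ₗ[K] N}
    (h : ∀ l, φ (pureTensor K l) = ψ (pureTensor K l)) : φ = ψ := by
  ext x
  induction x using pureTensor_induction with
  | pure l => exact h l
  | zero => simp
  | add x y hx hy => simp [hx, hy]
  | smul r x hx => simp [hx]

/-- `a ↦ (t ↦ a ⊗ t)`, for `a ∈ M` and `t ∈ T(M)`. -/
def cons : M →ₗ[K] TensorAlgebra K M →ₗ[K] TensorAlgebra K M :=
  LinearMap.mul K (TensorAlgebra K M) ∘ₗ TensorAlgebra.ι K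

variable {K M} in
@[simp] theorem cons_apply (a : M) (t : TensorAlgebra K M) :
    cons K M a t = TensorAlgebra.ι K a * t := rfl

/-- The projection `T(M) → M^{⊗0} = K`. -/
def aug : TensorAlgebra K M →ₗ[K] K :=
  (TensorAlgebra.algebraMapInv (R := K) (M := M)).toLinearMap

@[simp] theorem aug_one : aug K M 1 = 1 := by simp [aug]

variable {K M} in
@[simp] theorem aug_cons (a : M) (t : TensorAlgebra K M) :
    aug K M (TensorAlgebra.ι K a * t) = 0 := by
  simp [aug, TensorAlgebra.algebraMapInv]

/-- One step of the recursive definition of `deconc`. -/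
def deconcStep : M →ₗ[K] Module.End K (TensorAlgebra K M ⊗[K] TensorAlgebra K M) where
  toFun a := (cons K M a).rTensor (TensorAlgebra K M) +
    TensorProduct.mk K (TensorAlgebra K M) (TensorAlgebra K M) 1 ∘ₗ cons K M a ∘ₗ
      (TensorProduct.lid K (TensorAlgebra K M)).toLinearMap ∘ₗ
        (aug K M).rTensor (TensorAlgebra K M)
  map_add' a b := by
    ext x y
    simp [add_mul, TensorProduct.add_tmul, TensorProduct.tmul_add]
    abel
  map_smul' r a := by
    ext x y
    simp [TensorProduct.smul_tmul']

/-- The deconcatenation map, `a₁ ⊗ ⋯ ⊗ aₙ ↦ ∑ᵢ (a₁ ⊗ ⋯ ⊗ aᵢ) ⊗ (aᵢ₊₁ ⊗ ⋯ ⊗ aₙ)`, `0 ≤ i ≤ n`;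
see `deconc_pureTensor`. -/
def deconc : TensorAlgebra K M →ₗ[K] TensorAlgebra K M ⊗[K] TensorAlgebra K M :=
  LinearMap.applyₗ ((1 : TensorAlgebra K M) ⊗ₜ[K] (1 : TensorAlgebra K M)) ∘ₗ
    (TensorAlgebra.lift K (deconcStep K M)).toLinearMap

variable {K M}

@[simp] theorem deconc_one : deconc K M 1 = 1 ⊗ₜ 1 := by simp [deconc]

theorem deconc_cons' (a : M) (t : TensorAlgebra K M) :
    deconc K M (TensorAlgebra.ι K a * t) = deconcStep K M a (deconc K M t) := by
  simp [deconc]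

theorem lid_aug_deconc (t : TensorAlgebra K M) :
    TensorProduct.lid K (TensorAlgebra K M)
      ((aug K M).rTensor (TensorAlgebra K M) (deconc K M t)) = t := by
  induction t using pureTensor_induction with
  | zero => simp
  | add x y hx hy => simp [hx, hy]
  | smul r x hx => simp [hx]
  | pure l =>
    induction l with
    | nil => simp
    | cons a l ih =>
      have key : ∀ X : TensorAlgebra K M ⊗[K] TensorAlgebra K M,
          (aug K M).rTensor (TensorAlgebra K M)
            ((cons K M a).rTensor (TensorAlgebra K M) X) = 0 := by
        intro X
        induction X with
        | zero => simp
        | add x y hx hy => simp only [map_add, hx, hy, add_zero]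
        | tmul x y => simp
      rw [pureTensor_cons, deconc_cons']
      simp [deconcStep, key, ih]

theorem deconc_cons (a : M) (t : TensorAlgebra K M) :
    deconc K M (TensorAlgebra.ι K a * t) = 1 ⊗ₜ (TensorAlgebra.ι K a * t) +
      (cons K M a).rTensor (TensorAlgebra K M) (deconc K M t) := by
  rw [deconc_cons']
  simp [deconcStep, lid_aug_deconc, add_comm]

theorem deconc_pureTensor (l : List M) :
    deconc K M (pureTensor K l) =
      ∑ i ∈ Finset.range (l.length + 1), pureTensor K (l.take i) ⊗ₜ pureTensor K (l.drop i) := by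
  induction l with
  | nil => simp
  | cons a l ih =>
    rw [pureTensor_cons, deconc_cons, ih, List.length_cons,
      Finset.sum_range_succ' _ (l.length + 1), map_sum, add_comm]
    simp

/-- One step of the recursive definition of `shuffle`: `(a, φ) ↦ (s ↦ ∑ s' ⊗ a ⊗ φ(s''))`, the
sum being over all ways to write `s` as `s' ⊗ s''`. -/
def shuffleStep : M →ₗ[K] Module.End K (TensorAlgebra K M →ₗ[K] TensorAlgebra K M) :=
  LinearMap.mk₂ K
    (fun a φ => TensorProduct.lift ((LinearMap.mul K (TensorAlgebra K M)).compl₂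
      (cons K M a ∘ₗ φ)) ∘ₗ deconc K M)
    (by
      intro a b φ
      rw [← LinearMap.add_comp]
      congr 1
      ext x y
      simp [mul_add])
    (by
      intro r a φ
      rw [← LinearMap.smul_comp]
      congr 1
      ext x y
      simp)
    (by
      intro a φ ψ
      rw [← LinearMap.add_comp]
      congr 1
      ext x y
      simp [mul_add])
    (by
      intro r a φ
      rw [← LinearMap.smul_comp]
      congr 1
      ext x y
      simp)

variable (K M) in
/-- The shuffle product on `T(M)`. It is the bilinear map that satisfies the usual recursion, see
`shuffle_one`, `one_shuffle` and `shuffle_cons_cons`. -/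
def shuffle : TensorAlgebra K M →ₗ[K] TensorAlgebra K M →ₗ[K] TensorAlgebra K M :=
  LinearMap.applyₗ (LinearMap.id : TensorAlgebra K M →ₗ[K] TensorAlgebra K M) ∘ₗ
    (TensorAlgebra.lift K (shuffleStep (K := K) (M := M))).toLinearMap

@[simp] theorem one_shuffle (s : TensorAlgebra K M) : shuffle K M 1 s = s := by simp [shuffle]

theorem shuffle_cons (a : M) (t s : TensorAlgebra K M) :
    shuffle K M (TensorAlgebra.ι K a * t) s =
      TensorProduct.lift ((LinearMap.mul K (TensorAlgebra K M)).compl₂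
        (cons K M a ∘ₗ shuffle K M t)) (deconc K M s) := by
  simp [shuffle, shuffleStep]

@[simp] theorem shuffle_one (t : TensorAlgebra K M) : shuffle K M t 1 = t := by
  induction t using pureTensor_induction with
  | zero => simp
  | add x y hx hy => simp [hx, hy]
  | smul r x hx => simp [hx]
  | pure l =>
    induction l with
    | nil => simp
    | cons a l ih => rw [pureTensor_cons, shuffle_cons]; simp [ih]

/-- The recursion `(a ⊗ t) ⧢ (b ⊗ s) = a ⊗ (t ⧢ (b ⊗ s)) + b ⊗ ((a ⊗ t) ⧢ s)`. -/
theorem shuffle_cons_cons (a b : M) (t s : TensorAlgebra K M) :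
    shuffle K M (TensorAlgebra.ι K a * t) (TensorAlgebra.ι K b * s) =
      TensorAlgebra.ι K a * shuffle K M t (TensorAlgebra.ι K b * s) +
        TensorAlgebra.ι K b * shuffle K M (TensorAlgebra.ι K a * t) s := by
  rw [shuffle_cons, deconc_cons, shuffle_cons a t s]
  generalize deconc K M s = X
  have key : TensorProduct.lift ((LinearMap.mul K (TensorAlgebra K M)).compl₂
        (cons K M a ∘ₗ shuffle K M t)) ((cons K M b).rTensor (TensorAlgebra K M) X) =
      TensorAlgebra.ι K b * TensorProduct.lift ((LinearMap.mul K (TensorAlgebra K M)).compl₂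
        (cons K M a ∘ₗ shuffle K M t)) X := by
    induction X with
    | zero => simp
    | add x y hx hy => simp only [map_add, hx, hy, mul_add]
    | tmul x y => simp [mul_assoc]
  rw [map_add, key]
  simp

theorem shuffle_comm (t s : TensorAlgebra K M) : shuffle K M t s = shuffle K M s t := by
  suffices h : shuffle K M = (shuffle K M).flip from LinearMap.congr_fun₂ h t s
  refine ext_pureTensor fun l => ext_pureTensor fun k => ?_
  rw [LinearMap.flip_apply]
  induction l generalizing k with
  | nil => simp
  | cons a l ihl =>
    induction k with
    | nil => simp
    | cons b k ihk =>
      simp only [pureTensor_cons, shuffle_cons_cons] at *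
      rw [ihk]
      have := ihl (b :: k)
      rw [pureTensor_cons] at this
      rw [this, add_comm]

theorem shuffle_assoc_aux (n : ℕ) : ∀ l k r : List M, l.length + k.length + r.length = n →
    shuffle K M (shuffle K M (pureTensor K l) (pureTensor K k)) (pureTensor K r) =
      shuffle K M (pureTensor K l) (shuffle K M (pureTensor K k) (pureTensor K r)) := by
  induction n using Nat.strong_induction_on with
  | _ n ih =>
    intro l k r hn
    match l, k, r with
    | [], k, r => simp
    | a :: l, [], r => simp
    | a :: l, b :: k, [] => simp
    | a :: l, b :: k, c :: r =>
      simp only [List.length_cons] at hn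
      have h1 := ih (n - 1) (by omega) l (b :: k) (c :: r) (by simp; omega)
      have h2 := ih (n - 1) (by omega) (a :: l) k (c :: r) (by simp; omega)
      have h3 := ih (n - 1) (by omega) (a :: l) (b :: k) r (by simp; omega)
      simp only [pureTensor_cons, shuffle_cons_cons, map_add, LinearMap.add_apply] at h1 h2 h3 ⊢
      have e1 := congrArg (fun x => TensorAlgebra.ι K a * x) h1
      have e2 := congrArg (fun x => TensorAlgebra.ι K b * x) h2
      have e3 := congrArg (fun x => TensorAlgebra.ι K c * x) h3
      simp only [mul_add] at e1 e2 e3 ⊢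
      linear_combination (norm := abel) e1 + e2 + e3

theorem shuffle_assoc (t s u : TensorAlgebra K M) :
    shuffle K M (shuffle K M t s) u = shuffle K M t (shuffle K M s u) := by
  induction t using pureTensor_induction with
  | zero => simp
  | add x y hx hy => simp [hx, hy]
  | smul r x hx => simp [hx]
  | pure l =>
  induction s using pureTensor_induction with
  | zero => simp
  | add x y hx hy => simp [hx, hy]
  | smul r x hx => simp [hx]
  | pure k =>
  induction u using pureTensor_induction with
  | zero => simp
  | add x y hx hy => simp [hx, hy]
  | smul r x hx => simp [hx]
  | pure r => exact shuffle_assoc_aux _ l k r rfl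

end Shuffle

section ShuffleAlgebra

variable (K : Type*) [CommRing K] (M : Type*) [AddCommGroup M] [Module K M]

/-- The shuffle algebra `(T(M), +, ⧢)`: the module `T(M)` with the shuffle product. -/
def ShuffleAlgebra : Type _ := TensorAlgebra K M

namespace ShuffleAlgebra

instance : AddCommGroup (ShuffleAlgebra K M) := inferInstanceAs (AddCommGroup (TensorAlgebra K M))

instance : Module K (ShuffleAlgebra K M) := inferInstanceAs (Module K (TensorAlgebra K M))

/-- The identity map from the underlying module `T(M)` to the shuffle algebra. -/
def of : TensorAlgebra K M ≃ₗ[K] ShuffleAlgebra K M := LinearEquiv.refl K _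

instance : CommRing (ShuffleAlgebra K M) where
  __ := (inferInstance : AddCommGroup (ShuffleAlgebra K M))
  mul x y := of K M (shuffle K M ((of K M).symm x) ((of K M).symm y))
  one := of K M 1
  zero_mul x := congrArg (of K M) (LinearMap.map_zero₂ (shuffle K M) _)
  mul_zero x := congrArg (of K M) (map_zero (shuffle K M _))
  left_distrib x y z := congrArg (of K M) (map_add (shuffle K M _) _ _)
  right_distrib x y z := congrArg (of K M) (LinearMap.map_add₂ (shuffle K M) _ _ _)
  mul_assoc x y z := congrArg (of K M) (shuffle_assoc _ _ _)
  mul_comm x y := congrArg (of K M) (shuffle_comm _ _)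
  one_mul x := congrArg (of K M) (one_shuffle _)
  mul_one x := congrArg (of K M) (shuffle_one _)

theorem mul_def (x y : ShuffleAlgebra K M) :
    x * y = of K M (shuffle K M ((of K M).symm x) ((of K M).symm y)) := rfl

theorem one_def : (1 : ShuffleAlgebra K M) = of K M 1 := rfl

instance : Algebra K (ShuffleAlgebra K M) :=
  Algebra.ofModule
    (fun r _ _ => congrArg (of K M) (LinearMap.map_smul₂ (shuffle K M) r _ _))
    (fun r _ _ => congrArg (of K M) (map_smul (shuffle K M _) r _))

/-- The homogeneous component `M^{⊗n}` of the shuffle algebra, i.e. the span of all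
`a₁ ⊗ ⋯ ⊗ aₙ` (the power is taken with respect to the tensor product). -/
def component (n : ℕ) : Submodule K (ShuffleAlgebra K M) :=
  (LinearMap.range (TensorAlgebra.ι K (M := M)) ^ n).map (of K M).toLinearMap

end ShuffleAlgebra

end ShuffleAlgebra

section Constants

variable (K : Type*) [CommRing K]

/-- The symmetric square of `N`. -/
def SymSquare (N : Type*) [AddCommGroup N] [Module K N] : Type _ :=
  (N ⊗[K] N) ⧸ Submodule.span K {x : N ⊗[K] N | ∃ f g : N, x = f ⊗ₜ g - g ⊗ₜ f}

instance (N : Type*) [AddCommGroup N] [Module K N] : AddCommGroup (SymSquare K N) :=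
  inferInstanceAs (AddCommGroup ((N ⊗[K] N) ⧸ _))

instance (N : Type*) [AddCommGroup N] [Module K N] : Module K (SymSquare K N) :=
  inferInstanceAs (Module K ((N ⊗[K] N) ⧸ _))

/-- The symmetric product `(f, g) ↦ f ⊙ g`. -/
def symMul (N : Type*) [AddCommGroup N] [Module K N] : N →ₗ[K] N →ₗ[K] SymSquare K N :=
  (TensorProduct.mk K N N).compr₂ (Submodule.mkQ _)

theorem symMul_comm {N : Type*} [AddCommGroup N] [Module K N] (f g : N) :
    symMul K N f g = symMul K N g f :=
  (Submodule.Quotient.eq _).2 (Submodule.subset_span ⟨f, g, rfl⟩)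

variable (M : Type*) [AddCommGroup M] [Module K M]

/-- `T̃(M) = ⨁_{n ≥ 1} M^{⊗n}`, the tensors without component in degree `0`. -/
def PosTensor : Submodule K (TensorAlgebra K M) := LinearMap.ker (aug K M)

theorem posTensor_eq_iSup :
    PosTensor K M = ⨆ n : ℕ, LinearMap.range (TensorAlgebra.ι K (M := M)) ^ (n + 1) := by
  apply le_antisymm
  · intro x hx
    have key : ∀ y : TensorAlgebra K M, y - algebraMap K _ (aug K M y) ∈
        ⨆ n : ℕ, LinearMap.range (TensorAlgebra.ι K (M := M)) ^ (n + 1) := by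
      intro y
      induction y using pureTensor_induction with
      | zero => simp
      | add x y hx hy => simpa [add_sub_add_comm] using Submodule.add_mem _ hx hy
      | smul r x hx =>
        rw [map_smul, smul_eq_mul, map_mul, ← Algebra.smul_def, ← smul_sub]
        exact Submodule.smul_mem _ r hx
      | pure l =>
        cases l with
        | nil => simp
        | cons a l =>
          rw [pureTensor_cons, aug_cons, map_zero, sub_zero]
          refine Submodule.mem_iSup_of_mem l.length ?_
          rw [pow_succ']
          refine Submodule.mul_mem_mul ⟨a, rfl⟩ ?_
          induction l with
          | nil => simp
          | cons b l ih =>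
            rw [pureTensor_cons, List.length_cons, pow_succ']
            exact Submodule.mul_mem_mul ⟨b, rfl⟩ ih
    have hx' : aug K M x = 0 := hx
    simpa [hx'] using key x
  · refine iSup_le fun n => ?_
    rw [pow_succ', Submodule.mul_le]
    rintro _ ⟨a, rfl⟩ t _
    exact aug_cons a t

/-- The projection `T(M) → T̃(M)` that drops the component in degree `0`. -/
def toPos : TensorAlgebra K M →ₗ[K] PosTensor K M :=
  (LinearMap.id - Algebra.linearMap K (TensorAlgebra K M) ∘ₗ aug K M).codRestrict _
    (fun x => by simp [PosTensor, aug])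

/-- `toPos` is a projection, i.e. the identity on `T̃(M)`. -/
theorem toPos_coe (x : PosTensor K M) : toPos K M x = x := by
  have hx : aug K M x = 0 := x.2
  refine Subtype.ext ?_
  change (x : TensorAlgebra K M) - algebraMap K _ (aug K M x) = x
  simp [hx]

@[simp] theorem toPos_one : toPos K M 1 = 0 := by
  refine Subtype.ext ?_
  change (1 : TensorAlgebra K M) - algebraMap K _ (aug K M 1) = 0
  simp

/-- The symmetric algebra on `ε(M₂)`, where `M₂` is the symmetric square of `T̃(M)`. -/
abbrev SymM₂ : Type _ := SymmetricAlgebra K (SymSquare K (PosTensor K M))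

/-- `(f, g) ↦ ε(f ⊙ g) ∈ Sym(ε(M₂))` for `f, g ∈ T̃(M)`, extended to `T(M)` by zero in degree
`0`. -/
def preEps : TensorAlgebra K M →ₗ[K] TensorAlgebra K M →ₗ[K] SymM₂ K M :=
  ((symMul K (PosTensor K M)).compl₁₂ (toPos K M) (toPos K M)).compr₂
    (SymmetricAlgebra.ι K (SymSquare K (PosTensor K M)))

/-- The relation imposed on the constants for the pure tensors `f`, `g`, `h`. For
`f = f₁ ⊗ ⋯ ⊗ fₙ`, the tensors `f₁ ⊗ ⋯ ⊗ fᵢ` and `fᵢ₊₁ ⊗ ⋯ ⊗ fₙ` are given by `f.take i` and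
`f.drop i`. The lower bound `1 - j` is truncated, i.e. it is `max 0 (1 - j)`. -/
def constRel (f g h : List M) : SymM₂ K M :=
  preEps K M (shuffle K M (pureTensor K f) (pureTensor K g)) (pureTensor K h) -
    preEps K M (pureTensor K f) (shuffle K M (pureTensor K g) (pureTensor K h)) +
  ∑ j ∈ Finset.range g.length,
    (∑ i ∈ Finset.Ico (1 - j) f.length,
      preEps K M (pureTensor K (f.drop i)) (pureTensor K (g.drop j)) *
        preEps K M (shuffle K M (pureTensor K (f.take i)) (pureTensor K (g.take j)))
          (pureTensor K h) -
    ∑ k ∈ Finset.Ico (1 - j) h.length,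
      preEps K M (pureTensor K f)
          (shuffle K M (pureTensor K (g.take j)) (pureTensor K (h.take k))) *
        preEps K M (pureTensor K (g.drop j)) (pureTensor K (h.drop k)))

/-- The ideal of relations. -/
def J₂ : Ideal (SymM₂ K M) :=
  Ideal.span {x | ∃ f g h : List M, f ≠ [] ∧ g ≠ [] ∧ h ≠ [] ∧ x = constRel K M f g h}

/-- The algebra `C₂ = Sym(ε(M₂)) / J₂`. -/
def C₂ : Type _ := SymM₂ K M ⧸ J₂ K M

instance : CommRing (C₂ K M) := inferInstanceAs (CommRing (SymM₂ K M ⧸ J₂ K M))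

instance : Algebra K (C₂ K M) := inferInstanceAs (Algebra K (SymM₂ K M ⧸ J₂ K M))

/-- The quotient map `Sym(ε(M₂)) → C₂`. -/
def C₂.mk : SymM₂ K M →ₐ[K] C₂ K M := Ideal.Quotient.mkₐ K (J₂ K M)

/-- `(f, g) ↦ ε(f ⊙ g) ∈ C₂` for `f, g ∈ T̃(M)`, extended to `T(M)` by zero in degree `0`. -/
def eps : TensorAlgebra K M →ₗ[K] TensorAlgebra K M →ₗ[K] C₂ K M :=
  (preEps K M).compr₂ (C₂.mk K M).toLinearMap

variable {K M}

theorem eps_comm (f g : TensorAlgebra K M) : eps K M f g = eps K M g f := by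
  simp [eps, preEps, symMul_comm K (toPos K M f)]

@[simp] theorem eps_one (f : TensorAlgebra K M) : eps K M f 1 = 0 := by
  simp [eps, preEps]

@[simp] theorem one_eps (f : TensorAlgebra K M) : eps K M 1 f = 0 := by
  rw [eps_comm, eps_one]

/-- In the sums below, the terms with `i = n`, `j = m` or `i = j = 0` are zero, so that the
relations can be written with full index ranges. -/
theorem sum_Ico_eq (f g : List M) (φ : TensorAlgebra K M →ₗ[K] C₂ K M) (hφ : φ 1 = 0) :
    ∑ j ∈ Finset.range g.length, ∑ i ∈ Finset.Ico (1 - j) f.length,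
      eps K M (pureTensor K (f.drop i)) (pureTensor K (g.drop j)) *
        φ (shuffle K M (pureTensor K (f.take i)) (pureTensor K (g.take j))) =
    ∑ i ∈ Finset.range (f.length + 1), ∑ j ∈ Finset.range (g.length + 1),
      eps K M (pureTensor K (f.drop i)) (pureTensor K (g.drop j)) *
        φ (shuffle K M (pureTensor K (f.take i)) (pureTensor K (g.take j))) := by
  rw [Finset.sum_comm, Finset.sum_range_succ]
  simp only [Finset.sum_range_succ _ f.length, List.drop_length, pureTensor_nil, eps_one, one_eps,
    zero_mul, Finset.sum_const_zero, add_zero]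
  refine Finset.sum_congr rfl fun j _ => ?_
  refine Finset.sum_subset (fun i hi => by simp at hi ⊢; omega) fun i hi hi' => ?_
  have : i = 0 ∧ j = 0 := by simp at hi hi'; omega
  obtain ⟨rfl, rfl⟩ := this
  simp [hφ]

theorem eps_cocycle (f g h : List M) (hf : f ≠ []) (hg : g ≠ []) (hh : h ≠ []) :
    eps K M (shuffle K M (pureTensor K f) (pureTensor K g)) (pureTensor K h) +
      ∑ i ∈ Finset.range (f.length + 1), ∑ j ∈ Finset.range (g.length + 1),
        eps K M (pureTensor K (f.drop i)) (pureTensor K (g.drop j)) *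
          eps K M (shuffle K M (pureTensor K (f.take i)) (pureTensor K (g.take j)))
            (pureTensor K h) =
    eps K M (shuffle K M (pureTensor K g) (pureTensor K h)) (pureTensor K f) +
      ∑ i ∈ Finset.range (g.length + 1), ∑ j ∈ Finset.range (h.length + 1),
        eps K M (pureTensor K (g.drop i)) (pureTensor K (h.drop j)) *
          eps K M (shuffle K M (pureTensor K (g.take i)) (pureTensor K (h.take j)))
            (pureTensor K f) := by
  have h0 : C₂.mk K M (constRel K M f g h) = 0 :=
    Ideal.Quotient.eq_zero_iff_mem.2 (Ideal.subset_span ⟨f, g, h, hf, hg, hh, rfl⟩)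
  have hm : ∀ x y, C₂.mk K M (preEps K M x y) = eps K M x y :=
    fun _ _ => rfl
  simp only [constRel, map_add, map_sub, map_sum, map_mul, hm, Finset.sum_sub_distrib] at h0
  have h1 := sum_Ico_eq f g ((eps K M).flip (pureTensor K h)) (by simp)
  have h2 := sum_Ico_eq h g ((eps K M).flip (pureTensor K f)) (by simp)
  simp only [LinearMap.flip_apply] at h1 h2
  rw [h1] at h0
  rw [Finset.sum_comm (s := Finset.range (h.length + 1))] at h2
  have h3 : ∀ j k, eps K M (pureTensor K f)
      (shuffle K M (pureTensor K (g.take j)) (pureTensor K (h.take k))) *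
        eps K M (pureTensor K (g.drop j)) (pureTensor K (h.drop k)) =
      eps K M (pureTensor K (h.drop k)) (pureTensor K (g.drop j)) *
        eps K M (shuffle K M (pureTensor K (h.take k)) (pureTensor K (g.take j)))
          (pureTensor K f) := by
    intro j k
    rw [mul_comm, eps_comm (pureTensor K f), eps_comm (pureTensor K (g.drop j)),
      shuffle_comm (pureTensor K (g.take j))]
  simp only [h3] at h0
  rw [h2] at h0
  have h4 : ∀ j k, eps K M (pureTensor K (h.drop k)) (pureTensor K (g.drop j)) *
        eps K M (shuffle K M (pureTensor K (h.take k)) (pureTensor K (g.take j)))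
          (pureTensor K f) =
      eps K M (pureTensor K (g.drop j)) (pureTensor K (h.drop k)) *
          eps K M (shuffle K M (pureTensor K (g.take j)) (pureTensor K (h.take k)))
            (pureTensor K f) := by
    intro j k
    rw [eps_comm (pureTensor K (g.drop j)), shuffle_comm (pureTensor K (g.take j))]
  simp only [h4] at h0
  rw [eps_comm (pureTensor K f)] at h0
  linear_combination h0

end Constants

section GenShuffle

variable (K : Type*) [CommRing K] (M : Type*) [AddCommGroup M] [Module K M]

/-- `(f' ⊗ f'', g' ⊗ g'') ↦ ε(f'' ⊙ g'') ⊗ (f' ⧢ g')`. -/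
def epsShuffle : TensorAlgebra K M ⊗[K] TensorAlgebra K M →ₗ[K]
    TensorAlgebra K M ⊗[K] TensorAlgebra K M →ₗ[K] C₂ K M ⊗[K] TensorAlgebra K M :=
  TensorProduct.curry
    ((TensorProduct.comm K _ _).toLinearMap ∘ₗ
      TensorProduct.map (TensorProduct.lift (shuffle K M)) (TensorProduct.lift (eps K M)) ∘ₗ
        (TensorProduct.tensorTensorTensorComm K _ _ _ _).toLinearMap)

variable {K M} in
@[simp] theorem epsShuffle_tmul (f' f'' g' g'' : TensorAlgebra K M) :
    epsShuffle K M (f' ⊗ₜ f'') (g' ⊗ₜ g'') = eps K M f'' g'' ⊗ₜ shuffle K M f' g' := by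
  simp [epsShuffle]

/-- The product `(1 ⊗ f) · (1 ⊗ g)` in `C₂ ⊗ T(M)`. -/
def genShuffle : TensorAlgebra K M →ₗ[K] TensorAlgebra K M →ₗ[K] C₂ K M ⊗[K] TensorAlgebra K M :=
  (shuffle K M).compr₂ (TensorProduct.mk K (C₂ K M) (TensorAlgebra K M) 1) +
    (epsShuffle K M).compl₁₂ (deconc K M) (deconc K M)

/-- The multiplication of `C₂ ⊗ T(M)`, determined on pure tensors by `genMul_pureTensor`. -/
def genMul : (C₂ K M ⊗[K] TensorAlgebra K M) →ₗ[C₂ K M] (C₂ K M ⊗[K] TensorAlgebra K M) →ₗ[C₂ K M]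
    (C₂ K M ⊗[K] TensorAlgebra K M) :=
  LinearMap.liftBaseChange (C₂ K M)
    (((LinearMap.liftBaseChangeEquiv (C₂ K M)).toLinearMap.restrictScalars K) ∘ₗ genShuffle K M)

variable {K M}

theorem genMul_tmul (c d : C₂ K M) (f g : TensorAlgebra K M) :
    genMul K M (c ⊗ₜ f) (d ⊗ₜ g) = (c * d) • genShuffle K M f g := by
  simp [genMul, mul_smul]

theorem genShuffle_apply (f g : TensorAlgebra K M) :
    genShuffle K M f g =
      1 ⊗ₜ shuffle K M f g + epsShuffle K M (deconc K M f) (deconc K M g) := by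
  simp [genShuffle]

theorem genShuffle_pureTensor' (f g : List M) :
    genShuffle K M (pureTensor K f) (pureTensor K g) =
      1 ⊗ₜ shuffle K M (pureTensor K f) (pureTensor K g) +
      ∑ i ∈ Finset.range (f.length + 1), ∑ j ∈ Finset.range (g.length + 1),
        eps K M (pureTensor K (f.drop i)) (pureTensor K (g.drop j)) ⊗ₜ
          shuffle K M (pureTensor K (f.take i)) (pureTensor K (g.take j)) := by
  simp only [genShuffle_apply, deconc_pureTensor, map_sum, LinearMap.sum_apply, epsShuffle_tmul]
  rw [Finset.sum_comm]

/-- The defining formula of the multiplication of `C₂ ⊗ T(M)`. -/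
theorem genMul_pureTensor (c d : C₂ K M) (f g : List M) :
    genMul K M (c ⊗ₜ pureTensor K f) (d ⊗ₜ pureTensor K g) =
      (c * d) ⊗ₜ shuffle K M (pureTensor K f) (pureTensor K g) +
      ∑ i ∈ Finset.range f.length, ∑ j ∈ Finset.range g.length,
        (c * d * eps K M (pureTensor K (f.drop i)) (pureTensor K (g.drop j))) ⊗ₜ
          shuffle K M (pureTensor K (f.take i)) (pureTensor K (g.take j)) := by
  rw [genMul_tmul, genShuffle_pureTensor', Finset.sum_range_succ]
  simp only [Finset.sum_range_succ _ g.length, List.drop_length, pureTensor_nil, eps_one, one_eps,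
    TensorProduct.zero_tmul, Finset.sum_const_zero, add_zero, smul_add, Finset.smul_sum,
    TensorProduct.smul_tmul', smul_eq_mul, mul_one]

theorem epsShuffle_comm (X Y : TensorAlgebra K M ⊗[K] TensorAlgebra K M) :
    epsShuffle K M X Y = epsShuffle K M Y X := by
  induction X with
  | zero => simp
  | add x y hx hy => simp [hx, hy]
  | tmul x y =>
    induction Y with
    | zero => simp
    | add x y hx hy => simp [hx, hy]
    | tmul z w => simp [eps_comm y, shuffle_comm x]

theorem genShuffle_comm (f g : TensorAlgebra K M) :
    genShuffle K M f g = genShuffle K M g f := by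
  rw [genShuffle_apply, genShuffle_apply, shuffle_comm, epsShuffle_comm]

theorem base_induction {P : C₂ K M ⊗[K] TensorAlgebra K M → Prop}
    (pure : ∀ l : List M, P (1 ⊗ₜ pureTensor K l)) (zero : P 0)
    (add : ∀ x y, P x → P y → P (x + y)) (smul : ∀ (c : C₂ K M) x, P x → P (c • x))
    (x : C₂ K M ⊗[K] TensorAlgebra K M) : P x := by
  induction x with
  | zero => exact zero
  | add x y hx hy => exact add x y hx hy
  | tmul c t =>
    have key : P (1 ⊗ₜ t) := by
      induction t using pureTensor_induction with
      | pure l => exact pure l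
      | zero => simpa using zero
      | add x y hx hy => rw [TensorProduct.tmul_add]; exact add _ _ hx hy
      | smul r x hx =>
        have e : (1 : C₂ K M) ⊗ₜ[K] (r • x) = (algebraMap K (C₂ K M) r) • (1 ⊗ₜ[K] x) := by
          rw [TensorProduct.smul_tmul', TensorProduct.tmul_smul, TensorProduct.smul_tmul',
            smul_eq_mul, mul_one, Algebra.algebraMap_eq_smul_one]
        rw [e]
        exact smul _ _ hx
    have e : c ⊗ₜ[K] t = c • ((1 : C₂ K M) ⊗ₜ[K] t) := by
      rw [TensorProduct.smul_tmul', smul_eq_mul, mul_one]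
    rw [e]
    exact smul _ _ key

theorem ext_base {N : Type*} [AddCommGroup N] [Module (C₂ K M) N]
    {φ ψ : (C₂ K M ⊗[K] TensorAlgebra K M) →ₗ[C₂ K M] N}
    (h : ∀ l : List M, φ (1 ⊗ₜ pureTensor K l) = ψ (1 ⊗ₜ pureTensor K l)) : φ = ψ := by
  refine LinearMap.ext fun x => ?_
  induction x using base_induction with
  | pure l => exact h l
  | zero => simp
  | add x y hx hy => simp [hx, hy]
  | smul c x hx => simp [hx]

theorem genMul_comm (x y : C₂ K M ⊗[K] TensorAlgebra K M) :
    genMul K M x y = genMul K M y x := by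
  suffices h : genMul K M = (genMul K M).flip from LinearMap.congr_fun₂ h x y
  refine ext_base fun f => ext_base fun g => ?_
  rw [LinearMap.flip_apply, genMul_tmul, genMul_tmul, genShuffle_comm]

theorem one_genMul (x : C₂ K M ⊗[K] TensorAlgebra K M) : genMul K M (1 ⊗ₜ 1) x = x := by
  suffices h : genMul K M (1 ⊗ₜ 1) = LinearMap.id from LinearMap.congr_fun h x
  refine ext_base fun f => ?_
  simpa using genMul_pureTensor (K := K) 1 1 [] f

theorem genMul_one (x : C₂ K M ⊗[K] TensorAlgebra K M) : genMul K M x (1 ⊗ₜ 1) = x := by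
  rw [genMul_comm, one_genMul]

/-- `c ⊗ t ↦ c ⊗ (a ⊗ t)`. -/
def gcons (a : M) : (C₂ K M ⊗[K] TensorAlgebra K M) →ₗ[C₂ K M] (C₂ K M ⊗[K] TensorAlgebra K M) :=
  (cons K M a).baseChange (C₂ K M)

@[simp] theorem gcons_tmul (a : M) (c : C₂ K M) (t : TensorAlgebra K M) :
    gcons a (c ⊗ₜ t) = c ⊗ₜ (TensorAlgebra.ι K a * t) := by simp [gcons]

theorem epsShuffle_cons_cons (a b : M) (X Y : TensorAlgebra K M ⊗[K] TensorAlgebra K M) :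
    epsShuffle K M ((cons K M a).rTensor _ X) ((cons K M b).rTensor _ Y) =
      gcons a (epsShuffle K M X ((cons K M b).rTensor _ Y)) +
        gcons b (epsShuffle K M ((cons K M a).rTensor _ X) Y) := by
  induction X with
  | zero => simp
  | add x y hx hy => simp only [map_add, LinearMap.add_apply, hx, hy]; abel
  | tmul x y =>
    induction Y with
    | zero => simp
    | add x y hx hy => simp only [map_add, hx, hy]; abel
    | tmul z w => simp [shuffle_cons_cons, TensorProduct.tmul_add]

theorem epsShuffle_cons_one (a : M) (X : TensorAlgebra K M ⊗[K] TensorAlgebra K M)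
    (t : TensorAlgebra K M) :
    epsShuffle K M ((cons K M a).rTensor _ X) (1 ⊗ₜ t) =
      gcons a (epsShuffle K M X (1 ⊗ₜ t)) := by
  induction X with
  | zero => simp
  | add x y hx hy => simp only [map_add, LinearMap.add_apply, hx, hy]
  | tmul x y => simp

theorem genShuffle_cons_cons (a b : M) (t s : TensorAlgebra K M) :
    genShuffle K M (TensorAlgebra.ι K a * t) (TensorAlgebra.ι K b * s) =
      gcons a (genShuffle K M t (TensorAlgebra.ι K b * s)) +
      gcons b (genShuffle K M (TensorAlgebra.ι K a * t) s) +
      eps K M (TensorAlgebra.ι K a * t) (TensorAlgebra.ι K b * s) ⊗ₜ 1 := by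
  simp only [genShuffle_apply, deconc_cons, map_add, LinearMap.add_apply, shuffle_cons_cons,
    TensorProduct.tmul_add, gcons_tmul, epsShuffle_cons_cons, epsShuffle_cons_one,
    epsShuffle_tmul, one_shuffle]
  rw [epsShuffle_comm (1 ⊗ₜ[K] (TensorAlgebra.ι K a * t)), epsShuffle_cons_one,
    epsShuffle_comm _ (1 ⊗ₜ[K] (TensorAlgebra.ι K a * t))]
  abel

/-- `(c ⊗ t, h) ↦ c ε(t ⊙ h)`. -/
def geps (h : TensorAlgebra K M) : (C₂ K M ⊗[K] TensorAlgebra K M) →ₗ[C₂ K M] C₂ K M :=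
  LinearMap.liftBaseChange (C₂ K M) ((eps K M).flip h)

@[simp] theorem geps_tmul (h : TensorAlgebra K M) (c : C₂ K M) (t : TensorAlgebra K M) :
    geps h (c ⊗ₜ t) = c * eps K M t h := by simp [geps]

theorem gcons_genMul (a c : M) (u : C₂ K M ⊗[K] TensorAlgebra K M) (r : TensorAlgebra K M) :
    genMul K M (gcons a u) (1 ⊗ₜ (TensorAlgebra.ι K c * r)) =
      gcons a (genMul K M u (1 ⊗ₜ (TensorAlgebra.ι K c * r))) +
      gcons c (genMul K M (gcons a u) (1 ⊗ₜ r)) +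
      geps (TensorAlgebra.ι K c * r) (gcons a u) • (1 ⊗ₜ 1) := by
  induction u with
  | zero => simp
  | add x y hx hy => simp only [map_add, LinearMap.add_apply, hx, hy, add_smul]; abel
  | tmul d t =>
    simp only [gcons_tmul, genMul_tmul, genShuffle_cons_cons, smul_add, map_smul, geps_tmul,
      TensorProduct.smul_tmul', smul_eq_mul, mul_one]

/-- Left-multiplication by `a`, `b`, `c` is peeled off from a threefold product. -/
theorem genMul_expand (a b c : M) (t s r : TensorAlgebra K M) :
    genMul K M (genShuffle K M (TensorAlgebra.ι K a * t) (TensorAlgebra.ι K b * s))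
        (1 ⊗ₜ (TensorAlgebra.ι K c * r)) =
      gcons a (genMul K M (genShuffle K M t (TensorAlgebra.ι K b * s))
        (1 ⊗ₜ (TensorAlgebra.ι K c * r))) +
      gcons b (genMul K M (genShuffle K M (TensorAlgebra.ι K a * t) s)
        (1 ⊗ₜ (TensorAlgebra.ι K c * r))) +
      gcons c (genMul K M (genShuffle K M (TensorAlgebra.ι K a * t) (TensorAlgebra.ι K b * s))
        (1 ⊗ₜ r)) +
      geps (TensorAlgebra.ι K c * r)
        (genShuffle K M (TensorAlgebra.ι K a * t) (TensorAlgebra.ι K b * s)) • (1 ⊗ₜ 1) := by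
  have e : ∀ (d : C₂ K M) (x : TensorAlgebra K M),
      genMul K M (d ⊗ₜ 1) (1 ⊗ₜ x) = d ⊗ₜ x := by
    intro d x
    have : d ⊗ₜ[K] (1 : TensorAlgebra K M) = d • ((1 : C₂ K M) ⊗ₜ[K] 1) := by
      rw [TensorProduct.smul_tmul', smul_eq_mul, mul_one]
    rw [this, map_smul, LinearMap.smul_apply, one_genMul, TensorProduct.smul_tmul', smul_eq_mul,
      mul_one]
  simp only [genShuffle_cons_cons, map_add, LinearMap.add_apply, gcons_genMul, e, gcons_tmul,
    add_smul, geps_tmul, one_eps, mul_zero, zero_smul]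
  abel

theorem geps_genShuffle (f g h : List M) :
    geps (pureTensor K h) (genShuffle K M (pureTensor K f) (pureTensor K g)) =
      eps K M (shuffle K M (pureTensor K f) (pureTensor K g)) (pureTensor K h) +
      ∑ i ∈ Finset.range (f.length + 1), ∑ j ∈ Finset.range (g.length + 1),
        eps K M (pureTensor K (f.drop i)) (pureTensor K (g.drop j)) *
          eps K M (shuffle K M (pureTensor K (f.take i)) (pureTensor K (g.take j)))
            (pureTensor K h) := by
  simp [genShuffle_pureTensor', map_sum]

theorem genMul_assoc_aux (n : ℕ) : ∀ f g h : List M, f.length + g.length + h.length = n →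
    genMul K M (genShuffle K M (pureTensor K f) (pureTensor K g)) (1 ⊗ₜ pureTensor K h) =
      genMul K M (genShuffle K M (pureTensor K g) (pureTensor K h)) (1 ⊗ₜ pureTensor K f) := by
  have one : ∀ f g : TensorAlgebra K M,
      genShuffle K M f g = genMul K M (1 ⊗ₜ f) (1 ⊗ₜ g) := by
    intro f g; rw [genMul_tmul]; simp
  induction n using Nat.strong_induction_on with
  | _ n ih =>
    intro f g h hn
    match f, g, h with
    | [], g, h => simp [one, one_genMul, genMul_one]
    | a :: f, [], h =>
      simp [one, one_genMul, genMul_one]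
      rw [genMul_comm]
    | a :: f, b :: g, [] =>
      simp [one, one_genMul, genMul_one]
      rw [genMul_comm]
    | a :: f, b :: g, c :: h =>
      simp only [List.length_cons] at hn
      have h1 := ih (n - 1) (by omega) f (b :: g) (c :: h) (by simp; omega)
      have h2 := ih (n - 1) (by omega) (a :: f) g (c :: h) (by simp; omega)
      have h3 := ih (n - 1) (by omega) (a :: f) (b :: g) h (by simp; omega)
      have h4 := eps_cocycle (K := K) (a :: f) (b :: g) (c :: h) (by simp) (by simp) (by simp)
      rw [← geps_genShuffle, ← geps_genShuffle] at h4
      simp only [pureTensor_cons] at h1 h2 h3 h4 ⊢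
      rw [genMul_expand, genMul_expand, h1, h2, h3, h4]
      abel

theorem genMul_assoc (x y z : C₂ K M ⊗[K] TensorAlgebra K M) :
    genMul K M (genMul K M x y) z = genMul K M x (genMul K M y z) := by
  induction x using base_induction with
  | zero => simp
  | add x y hx hy => simp [hx, hy]
  | smul c x hx => simp [hx]
  | pure f =>
  induction y using base_induction with
  | zero => simp
  | add x y hx hy => simp [hx, hy]
  | smul c x hx => simp [hx]
  | pure g =>
  induction z using base_induction with
  | zero => simp
  | add x y hx hy => simp [hx, hy]
  | smul c x hx => simp [hx]
  | pure h =>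
    have := genMul_assoc_aux (K := K) _ f g h rfl
    rw [genMul_tmul, genMul_tmul, mul_one, one_smul, one_smul, this, genMul_comm]

/-- The algebra `(C₂ ⊗ T(M), +, ·)`: the module `C₂ ⊗ T(M)` with the product `genMul`. -/
def GenShuffle (K : Type*) [CommRing K] (M : Type*) [AddCommGroup M] [Module K M] : Type _ :=
  C₂ K M ⊗[K] TensorAlgebra K M

namespace GenShuffle

variable (K M)

instance : AddCommGroup (GenShuffle K M) :=
  inferInstanceAs (AddCommGroup (C₂ K M ⊗[K] TensorAlgebra K M))

instance : Module (C₂ K M) (GenShuffle K M) :=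
  inferInstanceAs (Module (C₂ K M) (C₂ K M ⊗[K] TensorAlgebra K M))

instance : Module K (GenShuffle K M) :=
  inferInstanceAs (Module K (C₂ K M ⊗[K] TensorAlgebra K M))

instance : IsScalarTower K (C₂ K M) (GenShuffle K M) :=
  inferInstanceAs (IsScalarTower K (C₂ K M) (C₂ K M ⊗[K] TensorAlgebra K M))

/-- The identity map from the module `C₂ ⊗ T(M)` to the algebra `(C₂ ⊗ T(M), +, ·)`. -/
def of : C₂ K M ⊗[K] TensorAlgebra K M ≃ₗ[C₂ K M] GenShuffle K M := LinearEquiv.refl (C₂ K M) _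

instance : CommRing (GenShuffle K M) where
  __ := (inferInstance : AddCommGroup (GenShuffle K M))
  mul x y := of K M (genMul K M ((of K M).symm x) ((of K M).symm y))
  one := of K M (1 ⊗ₜ 1)
  zero_mul x := congrArg (of K M) (LinearMap.map_zero₂ (genMul K M) _)
  mul_zero x := congrArg (of K M) (map_zero (genMul K M _))
  left_distrib x y z := congrArg (of K M) (map_add (genMul K M _) _ _)
  right_distrib x y z := congrArg (of K M) (LinearMap.map_add₂ (genMul K M) _ _ _)
  mul_assoc x y z := congrArg (of K M) (genMul_assoc _ _ _)
  mul_comm x y := congrArg (of K M) (genMul_comm _ _)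
  one_mul x := congrArg (of K M) (one_genMul _)
  mul_one x := congrArg (of K M) (genMul_one _)

theorem mul_def (x y : GenShuffle K M) :
    x * y = of K M (genMul K M ((of K M).symm x) ((of K M).symm y)) := rfl

theorem one_def : (1 : GenShuffle K M) = of K M (1 ⊗ₜ 1) := rfl

instance : Algebra (C₂ K M) (GenShuffle K M) :=
  Algebra.ofModule
    (fun r _ _ => congrArg (of K M) (LinearMap.map_smul₂ (genMul K M) r _ _))
    (fun r _ _ => congrArg (of K M) (map_smul (genMul K M _) r _))

instance : Algebra K (GenShuffle K M) :=
  Algebra.ofModule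
    (fun r x y => by
      rw [← algebraMap_smul (C₂ K M) r x, ← algebraMap_smul (C₂ K M) r (x * y), smul_mul_assoc])
    (fun r x y => by
      rw [← algebraMap_smul (C₂ K M) r y, ← algebraMap_smul (C₂ K M) r (x * y), mul_smul_comm])

/-- The element `1 ⊗ b`. -/
def oneTmul (b : ShuffleAlgebra K M) : GenShuffle K M :=
  of K M (1 ⊗ₜ (ShuffleAlgebra.of K M).symm b)

/-- The identity map to `C₂ ⊗ (T(M), +, ⧢)`, which carries the extended shuffle product
`(c ⊗ f) ⧢ (d ⊗ g) = cd ⊗ (f ⧢ g)`. -/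
def toShuffle : GenShuffle K M ≃ₗ[C₂ K M] C₂ K M ⊗[K] ShuffleAlgebra K M :=
  (of K M).symm.trans ((ShuffleAlgebra.of K M).baseChange K (C₂ K M) _ _)

/-- The extended shuffle product on `C₂ ⊗ T(M)`. -/
def extShuffle (x y : GenShuffle K M) : GenShuffle K M :=
  (toShuffle K M).symm (toShuffle K M x * toShuffle K M y)

theorem extShuffle_tmul (c d : C₂ K M) (f g : TensorAlgebra K M) :
    extShuffle K M (of K M (c ⊗ₜ f)) (of K M (d ⊗ₜ g)) = of K M ((c * d) ⊗ₜ shuffle K M f g) := by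
  have h : ∀ (c : C₂ K M) (f : TensorAlgebra K M),
      toShuffle K M (of K M (c ⊗ₜ f)) = c ⊗ₜ ShuffleAlgebra.of K M f := by
    intro c f
    simp [toShuffle]
  rw [extShuffle, LinearEquiv.symm_apply_eq, h, h, h, Algebra.TensorProduct.tmul_mul_tmul]
  rfl

/-- The homogeneous component `C₂ ⊗ M^{⊗n}` of `C₂ ⊗ T(M)`. -/
def component (n : ℕ) : Submodule (C₂ K M) (GenShuffle K M) :=
  Submodule.span (C₂ K M) (oneTmul K M '' ShuffleAlgebra.component K M n)

/-- `C₂ ⊗ Tₙ`, where `Tₙ = ⨁_{i ≤ n} M^{⊗i}`. -/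
def filtration (n : ℕ) : Submodule (C₂ K M) (GenShuffle K M) := ⨆ i ≤ n, component K M i

/-- The part `⨁_{i < n} C₂ ⊗ M^{⊗i}` of the filtration below `n`; it is zero for `n = 0`. -/
def filtrationLT (n : ℕ) : Submodule (C₂ K M) (GenShuffle K M) := ⨆ i < n, component K M i

end GenShuffle

end GenShuffle

section IDR

variable {R : Type*} [CommRing R]

/-- The ring of constants of a differential ring. -/
def constants (D : Derivation ℤ R R) : Subring R where
  carrier := {f | D f = 0}
  mul_mem' {f g} (hf : D f = 0) (hg : D g = 0) := show D (f * g) = 0 by simp [hf, hg]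
  one_mem' := show D 1 = 0 by simp
  add_mem' {f g} (hf : D f = 0) (hg : D g = 0) := show D (f + g) = 0 by simp [hf, hg]
  zero_mem' := show D 0 = 0 by simp
  neg_mem' {f} (hf : D f = 0) := show D (-f) = 0 by simp [hf]

/-- A quasi-integration `Q` on a commutative differential ring `(R, D)`: a linear map over the
constants with `DQD = D` and `QDQ = Q`. -/
structure QuasiIntegration (D : Derivation ℤ R R) where
  Q : R →ₗ[constants D] R
  deriv_Q_deriv : ∀ f, D (Q (D f)) = D f
  Q_deriv_Q : ∀ f, Q (D (Q f)) = Q f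

variable {D : Derivation ℤ R R} (q : QuasiIntegration D)

namespace QuasiIntegration

/-- `R_J`, the image of `Q`. -/
def RJ : Submodule (constants D) R := LinearMap.range q.Q

/-- `R_T`, the kernel of `Q`. -/
def RT : Submodule (constants D) R := LinearMap.ker q.Q

end QuasiIntegration

/-- `C₁ = Sym(ε(M₁))` with `M₁ = R_J ⊗ T(R_T)`. -/
def C₁ : Type _ :=
  SymmetricAlgebra (constants D) (q.RJ ⊗[constants D] TensorAlgebra (constants D) q.RT)

instance : CommRing (C₁ q) := inferInstanceAs (CommRing (SymmetricAlgebra (constants D) _))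

instance : Algebra (constants D) (C₁ q) :=
  inferInstanceAs (Algebra (constants D) (SymmetricAlgebra (constants D) _))

/-- The free commutative integro-differential ring on `(R, D)`, as commutative algebra over the
constants. -/
def IDR : Type _ := R ⊗[constants D] (C₁ q ⊗[constants D] GenShuffle (constants D) q.RT)

namespace IDR

instance : CommRing (IDR q) :=
  inferInstanceAs (CommRing (R ⊗[constants D] (C₁ q ⊗[constants D] GenShuffle (constants D) q.RT)))

instance : Algebra (constants D) (IDR q) :=
  inferInstanceAs (Algebra (constants D)
    (R ⊗[constants D] (C₁ q ⊗[constants D] GenShuffle (constants D) q.RT)))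

/-- The inclusion of `R ⊗ C₁ ⊗ C₂` into `IDR(R)`, `f ⊗ c₁ ⊗ c₂ ↦ f ⊗ c₁ ⊗ c₂ ⊗ 1`. -/
def coeffHom : R ⊗[constants D] (C₁ q ⊗[constants D] C₂ (constants D) q.RT) →ₐ[constants D] IDR q :=
  Algebra.TensorProduct.map (AlgHom.id (constants D) R)
    (Algebra.TensorProduct.map (AlgHom.id (constants D) (C₁ q))
      (IsScalarTower.toAlgHom (constants D) (C₂ (constants D) q.RT)
        (GenShuffle (constants D) q.RT)))

/-- The subring `R ⊗ C₁ ⊗ C₂ ⊗ C·1` of `IDR(R)`, where `C` are the constants of `R`. -/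
def coeffRing : Subalgebra (constants D) (IDR q) := (coeffHom q).range

/-- The element `1 ⊗ 1 ⊗ 1 ⊗ b`. -/
def oneTmul (b : ShuffleAlgebra (constants D) q.RT) : IDR q :=
  (1 : R) ⊗ₜ[constants D] ((1 : C₁ q) ⊗ₜ[constants D] GenShuffle.oneTmul (constants D) q.RT b)

end IDR

end IDR

/-- `X` is an algebra basis of the `A`-algebra `S`: it is algebraically independent over `A` and
generates `S` as `A`-algebra. -/
def IsAlgebraBasis (A : Type*) [CommRing A] {S : Type*} [CommRing S] [Algebra A S] (X : Set S) :
    Prop :=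
  AlgebraicIndependent A ((↑) : X → S) ∧ Algebra.adjoin A X = ⊤

end FreeIDR

end

open FreeIDR

/-! In the product of pure tensors of lengths `n` and `m`, every correction term contains a shuffle
of two proper prefixes, hence has length less than `n + m`. So the length filtration is
multiplicative, and the leading part of a product is the shuffle product (`mul_sub_extShuffle_mem`).
Everything else is the usual passage between a filtered algebra and its associated graded algebra,
followed by base change.

Give each variable the length of the homogeneous element substituted for it. For a weighted
homogeneous polynomial, the value under the shuffle product is the leading term of the value under
the full product (`isLeadingTerm_aeval`). A relation under the full product therefore forces its top
weighted component to be a relation under the shuffle product (`algebraicIndependent_oneTmul`).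
Conversely, a homogeneous element expressed as a shuffle polynomial is, up to lower terms, the same
polynomial under the full product (`aeval_oneTmul_surjective`). Both are inductions on the degree.

It remains to pass from `T` to `C₂ ⊗ T`, both with the shuffle product. Surjectivity of an
evaluation map survives tensoring. Injectivity may fail to do so, as `C₂` need not be flat, but it
survives if the map has a linear retraction, which is what a direct complement of the image provides
(`algebraicIndependent_one_tmul`). If `C₂` is semisimple, then so is the ring of constants, being
embedded in `C₂`, and complements always exist. For a basis the image is all of `T`, so the
complement is zero. Then `C₂ ⊗ T` is a polynomial algebra over `C₂`, and tensoring with `R ⊗ C₁`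
gives the last claim. -/

noncomputable section

namespace FreeIDR

/-! ### The length filtration of `C₂ ⊗ T` and its leading terms. -/

section Grading

variable (K : Type*) [CommRing K] (M : Type*) [AddCommGroup M] [Module K M]

/-- Products are only known explicitly on pure tensors; this spanning set reduces statements about
homogeneous elements to them. -/
theorem range_ι_pow_eq_span (n : ℕ) :
    LinearMap.range (TensorAlgebra.ι K (M := M)) ^ n =
      Submodule.span K (pureTensor K '' {l : List M | l.length = n}) := by
  induction n with
  | zero =>
    have h : {l : List M | l.length = 0} = {[]} := by ext l; simp
    rw [h, Set.image_singleton, pureTensor_nil, pow_zero, Submodule.one_eq_span]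
  | succ n ih =>
    rw [pow_succ', ih]
    apply le_antisymm
    · rw [Submodule.mul_le]
      rintro _ ⟨a, rfl⟩ t ht
      induction ht using Submodule.span_induction with
      | mem x hx =>
        obtain ⟨l, hl, rfl⟩ := hx
        exact Submodule.subset_span ⟨a :: l, by simpa using hl, by simp⟩
      | zero => simp
      | add x y _ _ hx hy => rw [mul_add]; exact Submodule.add_mem _ hx hy
      | smul r x _ hx => rw [mul_smul_comm]; exact Submodule.smul_mem _ _ hx
    · rw [Submodule.span_le]
      rintro _ ⟨l, hl, rfl⟩
      cases l with
      | nil => simp at hl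
      | cons a l =>
        rw [pureTensor_cons]
        exact Submodule.mul_mem_mul ⟨a, rfl⟩
          (Submodule.subset_span ⟨l, by simpa using hl, rfl⟩)

variable {K M}

theorem pureTensor_mem_pow (l : List M) :
    pureTensor K l ∈ LinearMap.range (TensorAlgebra.ι K (M := M)) ^ l.length := by
  rw [range_ι_pow_eq_span]
  exact Submodule.subset_span ⟨l, rfl, rfl⟩

/-- In the shuffle recursion, each summand puts one letter in front of a shuffle of total length one
less, so induction on the total length applies. -/
theorem shuffle_pureTensor_mem (n : ℕ) : ∀ l k : List M, l.length + k.length = n →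
    shuffle K M (pureTensor K l) (pureTensor K k) ∈
      LinearMap.range (TensorAlgebra.ι K (M := M)) ^ n := by
  induction n with
  | zero =>
    intro l k h
    obtain ⟨rfl, rfl⟩ : l = [] ∧ k = [] := by simpa using h
    simp
  | succ n ih =>
    intro l k h
    match l, k with
    | [], k =>
      have hk : k.length = n + 1 := by simpa using h
      simpa [hk] using pureTensor_mem_pow (K := K) k
    | a :: l, [] =>
      have hl : (a :: l).length = n + 1 := h
      rw [← hl, pureTensor_nil, shuffle_one]
      exact pureTensor_mem_pow (K := K) (a :: l)
    | a :: l, b :: k =>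
      simp only [List.length_cons] at h
      have h1 := ih l (b :: k) (by simp; omega)
      have h2 := ih (a :: l) k (by simp; omega)
      simp only [pureTensor_cons, shuffle_cons_cons, pow_succ'] at h1 h2 ⊢
      exact Submodule.add_mem _ (Submodule.mul_mem_mul ⟨a, rfl⟩ h1)
        (Submodule.mul_mem_mul ⟨b, rfl⟩ h2)

namespace GenShuffle

variable (K M) in
theorem component_eq_span (n : ℕ) :
    component K M n = Submodule.span (C₂ K M)
      ((fun l => of K M (1 ⊗ₜ pureTensor K l)) '' {l : List M | l.length = n}) := by
  apply le_antisymm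
  · rw [component, Submodule.span_le]
    rintro _ ⟨_, ⟨t, ht, rfl⟩, rfl⟩
    rw [SetLike.mem_coe, range_ι_pow_eq_span] at ht
    change of K M (1 ⊗ₜ t) ∈ _
    induction ht using Submodule.span_induction with
    | mem x hx =>
      obtain ⟨l, hl, rfl⟩ := hx
      exact Submodule.subset_span ⟨l, hl, rfl⟩
    | zero => simp
    | add x y _ _ hx hy =>
      rw [TensorProduct.tmul_add, map_add]
      exact Submodule.add_mem _ hx hy
    | smul r x _ hx =>
      have e : (1 : C₂ K M) ⊗ₜ[K] (r • x) = (algebraMap K (C₂ K M) r) • (1 ⊗ₜ[K] x) := by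
        rw [TensorProduct.tmul_smul, algebraMap_smul]
      rw [e, map_smul]
      exact Submodule.smul_mem _ _ hx
  · rw [Submodule.span_le]
    rintro _ ⟨l, hl, rfl⟩
    exact Submodule.subset_span
      ⟨ShuffleAlgebra.of K M (pureTensor K l), ⟨_, hl ▸ pureTensor_mem_pow l, rfl⟩, rfl⟩

theorem of_tmul_mem_component (c : C₂ K M) {n : ℕ} {t : TensorAlgebra K M}
    (ht : t ∈ LinearMap.range (TensorAlgebra.ι K (M := M)) ^ n) :
    of K M (c ⊗ₜ t) ∈ component K M n := by
  have e : c ⊗ₜ[K] t = c • ((1 : C₂ K M) ⊗ₜ[K] t) := by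
    rw [TensorProduct.smul_tmul', smul_eq_mul, mul_one]
  rw [e, map_smul]
  exact Submodule.smul_mem _ _ (Submodule.subset_span ⟨ShuffleAlgebra.of K M t, ⟨t, ht, rfl⟩, rfl⟩)

theorem component_le_filtration {i n : ℕ} (h : i ≤ n) : component K M i ≤ filtration K M n :=
  le_iSup₂_of_le i h le_rfl

theorem component_le_filtrationLT {i n : ℕ} (h : i < n) :
    component K M i ≤ filtrationLT K M n :=
  le_iSup₂_of_le i h le_rfl

variable (K M) in
theorem filtration_mono : Monotone (filtration K M) := fun _ _ h =>
  iSup₂_le fun _ hi => component_le_filtration (hi.trans h)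

theorem filtration_le_filtrationLT {i n : ℕ} (h : i < n) :
    filtration K M i ≤ filtrationLT K M n :=
  iSup₂_le fun _ hj => component_le_filtrationLT (hj.trans_lt h)

variable (K M) in
theorem filtrationLT_succ (n : ℕ) : filtrationLT K M (n + 1) = filtration K M n := by
  simp only [filtrationLT, filtration, Nat.lt_succ_iff]

variable (K M) in
theorem filtration_eq_sup (n : ℕ) :
    filtration K M n = filtrationLT K M n ⊔ component K M n := by
  apply le_antisymm
  · refine iSup₂_le fun i hi => ?_
    rcases hi.lt_or_eq with h | rfl
    · exact le_sup_of_le_left (component_le_filtrationLT h)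
    · exact le_sup_right
  · exact sup_le (iSup₂_le fun i hi => component_le_filtration hi.le)
      (component_le_filtration le_rfl)

variable (K M) in
theorem iSup_filtration : ⨆ n, filtration K M n = ⊤ := by
  rw [eq_top_iff]
  rintro x -
  induction x using base_induction with
  | pure l =>
    exact Submodule.mem_iSup_of_mem l.length
      (component_le_filtration le_rfl (of_tmul_mem_component 1 (pureTensor_mem_pow l)))
  | zero => exact Submodule.zero_mem _
  | add x y hx hy => exact Submodule.add_mem _ hx hy
  | smul c x hx => exact Submodule.smul_mem _ c hx

/-- The leading term of a product of homogeneous elements is their shuffle product. -/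
theorem mul_sub_extShuffle_mem {n m : ℕ} {x y : GenShuffle K M} (hx : x ∈ component K M n)
    (hy : y ∈ component K M m) :
    extShuffle K M x y ∈ component K M (n + m) ∧
      x * y - extShuffle K M x y ∈ filtrationLT K M (n + m) := by
  rw [component_eq_span] at hx hy
  induction hx using Submodule.span_induction with
  | zero => simp [extShuffle]
  | add x x' _ _ hx hx' =>
    have e : extShuffle K M (x + x') y = extShuffle K M x y + extShuffle K M x' y := by
      simp [extShuffle, add_mul]
    rw [e, add_mul, add_sub_add_comm]
    exact ⟨Submodule.add_mem _ hx.1 hx'.1, Submodule.add_mem _ hx.2 hx'.2⟩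
  | smul c x _ hx =>
    have e : extShuffle K M (c • x) y = c • extShuffle K M x y := by
      rw [extShuffle, map_smul]
      exact (congrArg _ (Algebra.smul_mul_assoc c (toShuffle K M x) (toShuffle K M y))).trans
        (map_smul (toShuffle K M).symm c _)
    rw [e, smul_mul_assoc, ← smul_sub]
    exact ⟨Submodule.smul_mem _ c hx.1, Submodule.smul_mem _ c hx.2⟩
  | mem x hx =>
  induction hy using Submodule.span_induction with
  | zero => simp [extShuffle]
  | add y y' _ _ hy hy' =>
    have e : extShuffle K M x (y + y') = extShuffle K M x y + extShuffle K M x y' := by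
      simp [extShuffle, mul_add]
    rw [e, mul_add, add_sub_add_comm]
    exact ⟨Submodule.add_mem _ hy.1 hy'.1, Submodule.add_mem _ hy.2 hy'.2⟩
  | smul c y _ hy =>
    have e : extShuffle K M x (c • y) = c • extShuffle K M x y := by
      rw [extShuffle, map_smul]
      exact (congrArg _ (Algebra.mul_smul_comm c (toShuffle K M x) (toShuffle K M y))).trans
        (map_smul (toShuffle K M).symm c _)
    rw [e, mul_smul_comm, ← smul_sub]
    exact ⟨Submodule.smul_mem _ c hy.1, Submodule.smul_mem _ c hy.2⟩
  | mem y hy =>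
    obtain ⟨f, hf, rfl⟩ := hx
    obtain ⟨g, hg, rfl⟩ := hy
    simp only [Set.mem_ofPred_eq] at hf hg
    subst hf hg
    have e : of K M (1 ⊗ₜ pureTensor K f) * of K M (1 ⊗ₜ pureTensor K g) =
        of K M (genMul K M (1 ⊗ₜ pureTensor K f) (1 ⊗ₜ pureTensor K g)) := rfl
    simp only [extShuffle_tmul, e, genMul_pureTensor, map_add, mul_one, one_mul,
      add_sub_cancel_left, map_sum]
    refine ⟨of_tmul_mem_component 1 (shuffle_pureTensor_mem _ f g rfl),
      Submodule.sum_mem _ fun i hi => Submodule.sum_mem _ fun j hj => ?_⟩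
    rw [Finset.mem_range] at hi hj
    -- A correction term shuffles prefixes of lengths `i < f.length` and `j < g.length`, so its
    -- length `i + j` is strictly below the total.
    refine component_le_filtrationLT (i := i + j) (by omega)
      (of_tmul_mem_component _ (shuffle_pureTensor_mem _ _ _ ?_))
    simp only [List.length_take]
    omega

theorem mul_mem_filtration {n m : ℕ} {x y : GenShuffle K M} (hx : x ∈ filtration K M n)
    (hy : y ∈ filtration K M m) : x * y ∈ filtration K M (n + m) := by
  suffices h : ∀ i ≤ n, ∀ j ≤ m, ∀ x ∈ component K M i, ∀ y ∈ component K M j,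
      x * y ∈ filtration K M (n + m) by
    have h1 : ∀ i ≤ n, ∀ x ∈ component K M i, x * y ∈ filtration K M (n + m) := by
      intro i hi x hx
      have : filtration K M m ≤ (filtration K M (n + m)).comap (LinearMap.mulLeft (C₂ K M) x) :=
        iSup₂_le fun j hj y hy => h i hi j hj x hx y hy
      exact this hy
    have : filtration K M n ≤ (filtration K M (n + m)).comap (LinearMap.mulRight (C₂ K M) y) :=
      iSup₂_le fun i hi x hx => h1 i hi x hx
    exact this hx
  intro i hi j hj x hx y hy
  obtain ⟨h1, h2⟩ := mul_sub_extShuffle_mem hx hy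
  have h3 := Submodule.add_mem (filtration K M (i + j))
    (filtration_eq_sup K M (i + j) ▸ Submodule.mem_sup_left h2)
    (component_le_filtration le_rfl h1)
  rw [sub_add_cancel] at h3
  exact filtration_mono K M (by omega) h3

/-- Lower-order errors stay of lower order after multiplication, which makes leading terms
multiplicative. For `n = 0` the strict part is zero, so this case is separate. -/
theorem mul_mem_filtrationLT {n m : ℕ} {x y : GenShuffle K M} (hx : x ∈ filtrationLT K M n)
    (hy : y ∈ filtration K M m) : x * y ∈ filtrationLT K M (n + m) := by
  cases n with
  | zero =>
    have : x = 0 := by simpa [filtrationLT] using hx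
    simp [this]
  | succ n =>
    rw [filtrationLT_succ] at hx
    exact filtration_le_filtrationLT (by omega) (mul_mem_filtration hx hy)

variable (K M) in
theorem isRingFiltration_filtration :
    IsRingFiltration (filtration K M) (filtrationLT K M) where
  mono := filtration_mono K M
  is_le h := filtration_le_filtrationLT h
  is_sup _ _ h := iSup₂_le fun i hi => (component_le_filtration le_rfl).trans (h i hi)
  one_mem := component_le_filtration le_rfl
    (of_tmul_mem_component 1 (pureTensor_mem_pow (K := K) (M := M) []))
  mul_mem _ _ _ _ hx hy := mul_mem_filtration hx hy

variable (K M) in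
/-- The projection `C₂ ⊗ T(M) → C₂ ⊗ M^{⊗n}`. -/
def proj (n : ℕ) : GenShuffle K M →ₗ[C₂ K M] GenShuffle K M :=
  (of K M).toLinearMap ∘ₗ
    (GradedAlgebra.proj (LinearMap.range (TensorAlgebra.ι K (M := M)) ^ ·) n).baseChange
      (C₂ K M) ∘ₗ (of K M).symm.toLinearMap

/-- The projections are base changes of those of the graded tensor algebra. Being linear maps, they
survive tensoring with `C₂` without flatness, and thus separate the components of `C₂ ⊗ T`. -/
theorem proj_of_pureTensor (n : ℕ) (l : List M) :
    proj K M n (of K M (1 ⊗ₜ pureTensor K l)) =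
      if l.length = n then of K M (1 ⊗ₜ pureTensor K l) else 0 := by
  simp only [proj, LinearMap.comp_apply, LinearEquiv.coe_coe, LinearEquiv.symm_apply_apply,
    LinearMap.baseChange_tmul, GradedAlgebra.proj_apply]
  split_ifs with h
  · rw [DirectSum.decompose_of_mem_same _ (h ▸ pureTensor_mem_pow l)]
  · rw [DirectSum.decompose_of_mem_ne _ (pureTensor_mem_pow l) h, TensorProduct.tmul_zero,
      map_zero]

theorem proj_of_mem {n : ℕ} {x : GenShuffle K M} (hx : x ∈ component K M n) :
    proj K M n x = x := by
  rw [component_eq_span] at hx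
  refine LinearMap.eqOn_span (g := LinearMap.id) ?_ hx
  rintro _ ⟨l, hl, rfl⟩
  exact (proj_of_pureTensor n l).trans (if_pos hl)

theorem proj_of_mem_ne {n m : ℕ} (h : m ≠ n) {x : GenShuffle K M} (hx : x ∈ component K M m) :
    proj K M n x = 0 := by
  rw [component_eq_span] at hx
  refine LinearMap.eqOn_span (g := 0) ?_ hx
  rintro _ ⟨l, hl, rfl⟩
  refine (proj_of_pureTensor n l).trans (if_neg ?_)
  rw [Set.mem_ofPred_eq] at hl
  omega

variable (K M) in
theorem disjoint_filtrationLT_component (n : ℕ) :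
    Disjoint (filtrationLT K M n) (component K M n) := by
  rw [Submodule.disjoint_def]
  intro x hx hx'
  have h : filtrationLT K M n ≤ LinearMap.ker (proj K M n) :=
    iSup₂_le fun i hi y hy => proj_of_mem_ne hi.ne hy
  rw [← proj_of_mem hx']
  exact h hx

end GenShuffle

end Grading

/-! ### Transfer from the shuffle product to the full product. -/

section Transfer

open MvPolynomial

variable {K : Type*} [CommRing K] {M : Type*} [AddCommGroup M] [Module K M]
  {ι : Type*} {t : ι → ShuffleAlgebra K M} {w : ι → ℕ}

namespace GenShuffle

theorem toShuffle_oneTmul (b : ShuffleAlgebra K M) :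
    toShuffle K M (oneTmul K M b) = 1 ⊗ₜ[K] b := by
  simp [toShuffle, oneTmul]

/-- `y` is homogeneous of degree `n` and the leading term of `x`. -/
def IsLeadingTerm (n : ℕ) (x : GenShuffle K M) (y : C₂ K M ⊗[K] ShuffleAlgebra K M) : Prop :=
  (toShuffle K M).symm y ∈ component K M n ∧ x - (toShuffle K M).symm y ∈ filtrationLT K M n

namespace IsLeadingTerm

variable {n m : ℕ} {x x' : GenShuffle K M} {y y' : C₂ K M ⊗[K] ShuffleAlgebra K M}

theorem mem_filtration (h : IsLeadingTerm n x y) : x ∈ filtration K M n := by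
  rw [filtration_eq_sup, ← sub_add_cancel x ((toShuffle K M).symm y)]
  exact Submodule.add_mem_sup h.2 h.1

variable (K M) in
theorem zero (n : ℕ) : IsLeadingTerm (K := K) (M := M) n 0 0 := by
  simp [IsLeadingTerm]

theorem add (h : IsLeadingTerm n x y) (h' : IsLeadingTerm n x' y') :
    IsLeadingTerm n (x + x') (y + y') := by
  rw [IsLeadingTerm, map_add, add_sub_add_comm]
  exact ⟨Submodule.add_mem _ h.1 h'.1, Submodule.add_mem _ h.2 h'.2⟩

theorem smul (c : C₂ K M) (h : IsLeadingTerm n x y) : IsLeadingTerm n (c • x) (c • y) := by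
  rw [IsLeadingTerm, map_smul, ← smul_sub]
  exact ⟨Submodule.smul_mem _ c h.1, Submodule.smul_mem _ c h.2⟩

theorem mul (h : IsLeadingTerm n x y) (h' : IsLeadingTerm m x' y') :
    IsLeadingTerm (n + m) (x * x') (y * y') := by
  have e : (toShuffle K M).symm (y * y') =
      extShuffle K M ((toShuffle K M).symm y) ((toShuffle K M).symm y') := by
    simp [extShuffle]
  obtain ⟨h1, h2⟩ := mul_sub_extShuffle_mem h.1 h'.1
  rw [IsLeadingTerm, e]
  refine ⟨h1, ?_⟩
  have h3 := mul_mem_filtrationLT h.2 h'.mem_filtration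
  have h4 := mul_mem_filtrationLT h'.2 (component_le_filtration le_rfl h.1)
  rw [add_comm m] at h4
  -- With `y`, `y'` read in `C₂ ⊗ T` and `⧢` the extended shuffle product, this is the splitting `x
  -- x' - y ⧢ y' = (x - y) x' + (x' - y') y + (y y' - y ⧢ y')`.
  convert! Submodule.add_mem _ (Submodule.add_mem _ h3 h4) h2 using 1
  ring

theorem of_mem {b : ShuffleAlgebra K M} (hb : b ∈ ShuffleAlgebra.component K M n) :
    IsLeadingTerm n (oneTmul K M b) (1 ⊗ₜ[K] b) := by
  have e : (toShuffle K M).symm (1 ⊗ₜ[K] b) = oneTmul K M b := by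
    rw [LinearEquiv.symm_apply_eq, toShuffle_oneTmul]
  rw [IsLeadingTerm, e, sub_self]
  exact ⟨Submodule.subset_span ⟨b, hb, rfl⟩, Submodule.zero_mem _⟩

variable (K M) in
theorem one : IsLeadingTerm (K := K) (M := M) 0 1 1 :=
  of_mem (b := 1) ⟨1, by simp, rfl⟩

end IsLeadingTerm

/-- For a polynomial that is homogeneous for the weights `w`, the value in
`C₂ ⊗ (T(M), +, ⧢)` is the leading term of the value in `(C₂ ⊗ T(M), +, ·)`. -/
theorem isLeadingTerm_aeval (ht : ∀ i, t i ∈ ShuffleAlgebra.component K M (w i)) {n : ℕ}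
    {p : MvPolynomial ι (C₂ K M)} (hp : p.IsWeightedHomogeneous w n) :
    IsLeadingTerm n (aeval (fun i => oneTmul K M (t i)) p)
      (aeval (fun i => (1 : C₂ K M) ⊗ₜ[K] t i) p) := by
  induction hp using IsWeightedHomogeneous.induction_on with
  | zero => simpa using IsLeadingTerm.zero K M n
  | add p q _ _ hp hq => simpa only [map_add] using hp.add hq
  | monomial d c hd =>
    subst hd
    have h : monomial d c = c • monomial d (1 : C₂ K M) := by simp [smul_monomial]
    rw [h, map_smul, map_smul]
    refine IsLeadingTerm.smul c ?_
    -- The monomial is built up from single variables; weights add under products, as do the degrees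
    -- of leading terms.
    induction d using Finsupp.induction_linear with
    | zero => simpa using IsLeadingTerm.one K M
    | add d e hd he =>
      have h : monomial (d + e) (1 : C₂ K M) = monomial d 1 * monomial e 1 := by simp
      simp only [h, map_mul, map_add]
      exact (hd (by simp [smul_monomial])).mul (he (by simp [smul_monomial]))
    | single i k =>
      induction k with
      | zero => simpa using IsLeadingTerm.one K M
      | succ k ih =>
        have h : monomial (Finsupp.single i (k + 1)) (1 : C₂ K M) =
            monomial (Finsupp.single i k) 1 * X i := by
          rw [← X_pow_eq_monomial, ← X_pow_eq_monomial, pow_succ]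
        have h' : Finsupp.weight w (Finsupp.single i (k + 1)) =
            Finsupp.weight w (Finsupp.single i k) + w i := by
          simp [Finsupp.weight_single]
        simp only [h, h', map_mul, aeval_X]
        exact (ih (by simp [smul_monomial])).mul (IsLeadingTerm.of_mem (ht i))

/-- Under the shuffle product a monomial of weight `k` takes a value of length exactly `k`, so
weighted components of a polynomial match length components of its value. Hence a homogeneous value
is already attained by one weighted component. -/
theorem proj_aeval (ht : ∀ i, t i ∈ ShuffleAlgebra.component K M (w i)) (n : ℕ)
    (p : MvPolynomial ι (C₂ K M)) :
    proj K M n ((toShuffle K M).symm (aeval (fun i => (1 : C₂ K M) ⊗ₜ[K] t i) p)) =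
      (toShuffle K M).symm
        (aeval (fun i => (1 : C₂ K M) ⊗ₜ[K] t i) (weightedHomogeneousComponent w n p)) := by
  induction p using MvPolynomial.induction_on' with
  | add p q hp hq => simp only [map_add, hp, hq]
  | monomial d c =>
    have hd := isWeightedHomogeneous_monomial w d c rfl
    have h := (isLeadingTerm_aeval ht hd).1
    by_cases hn : Finsupp.weight w d = n
    · subst hn
      rw [hd.weightedHomogeneousComponent_same, proj_of_mem h]
    · rw [hd.weightedHomogeneousComponent_ne _ (Ne.symm hn), proj_of_mem_ne hn h, map_zero, map_zero]

/-- If homogeneous elements are algebraically independent in `C₂ ⊗ (T(M), +, ⧢)`, they are so in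
`(C₂ ⊗ T(M), +, ·)`. -/
theorem algebraicIndependent_oneTmul (ht : ∀ i, t i ∈ ShuffleAlgebra.component K M (w i))
    (h : AlgebraicIndependent (C₂ K M) fun i => (1 : C₂ K M) ⊗ₜ[K] t i) :
    AlgebraicIndependent (C₂ K M) fun i => oneTmul K M (t i) := by
  rw [algebraicIndependent_iff]
  -- The bound on the value is proved together with injectivity, since the induction needs it to
  -- control the terms below the top component. The strict bound makes `n = 0` the case `p = 0`.
  suffices key : ∀ (n : ℕ) (p : MvPolynomial ι (C₂ K M)),
      (∀ d ∈ p.support, Finsupp.weight w d < n) →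
        aeval (fun i => oneTmul K M (t i)) p ∈ filtrationLT K M n ∧
        (aeval (fun i => oneTmul K M (t i)) p = 0 → p = 0) by
    intro p hp
    obtain ⟨n, hn⟩ : ∃ n, ∀ d ∈ p.support, Finsupp.weight w d < n :=
      ⟨p.weightedTotalDegree w + 1, fun d hd => Nat.lt_succ_of_le (le_weightedTotalDegree w hd)⟩
    exact (key n p hn).2 hp
  intro n
  induction n with
  | zero =>
    intro p hp
    have : p = 0 := by
      rw [← support_eq_empty, Finset.eq_empty_iff_forall_notMem]
      exact fun d hd => Nat.not_lt_zero _ (hp d hd)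
    simp [this]
  | succ n ih =>
    intro p hp
    -- Removing the component of the top possible weight `n` leaves only smaller weights.
    have hq : ∀ d ∈ (p - weightedHomogeneousComponent w n p).support,
        Finsupp.weight w d < n := by
      intro d hd
      rw [mem_support_iff, coeff_sub, coeff_weightedHomogeneousComponent] at hd
      split_ifs at hd with hdn
      · simp at hd
      · have := hp d (mem_support_iff.2 (by simpa using hd))
        omega
    obtain ⟨h1, h2⟩ := ih _ hq
    have h3 := isLeadingTerm_aeval ht (weightedHomogeneousComponent_isWeightedHomogeneous n p)
    have h4 : aeval (fun i => oneTmul K M (t i)) p =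
        aeval (fun i => oneTmul K M (t i)) (p - weightedHomogeneousComponent w n p) +
          aeval (fun i => oneTmul K M (t i)) (weightedHomogeneousComponent w n p) := by
      rw [← map_add, sub_add_cancel]
    refine ⟨?_, fun h0 => ?_⟩
    · rw [filtrationLT_succ, h4]
      refine Submodule.add_mem _ ?_ h3.mem_filtration
      rw [filtration_eq_sup]
      exact Submodule.mem_sup_left h1
    · have h5 : weightedHomogeneousComponent w n p = 0 := by
        refine h.eq_zero_of_aeval_eq_zero _ ?_
        rw [← (toShuffle K M).symm.map_eq_zero_iff]
        -- If the value of `p` vanishes, the leading term is minus a sum of lower terms. It thus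
        -- lies both in degree `n` and strictly below, so it is zero.
        refine Submodule.disjoint_def.1 (disjoint_filtrationLT_component K M n) _ ?_ h3.1
        have h6 := Submodule.neg_mem _ (Submodule.add_mem _ h1 h3.2)
        rw [← add_sub_assoc, ← h4, h0] at h6
        simpa using h6
      rw [h5, sub_zero] at h2
      exact h2 h0

/-- If homogeneous elements generate `C₂ ⊗ (T(M), +, ⧢)`, they generate
`(C₂ ⊗ T(M), +, ·)`. -/
theorem aeval_oneTmul_surjective (ht : ∀ i, t i ∈ ShuffleAlgebra.component K M (w i))
    (h : Function.Surjective (aeval (R := C₂ K M) fun i => (1 : C₂ K M) ⊗ₜ[K] t i)) :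
    Function.Surjective (aeval (R := C₂ K M) fun i => oneTmul K M (t i)) := by
  -- With the strict filtration the induction starts at the zero submodule.
  suffices key : ∀ n, filtrationLT K M n ≤
      LinearMap.range (aeval (R := C₂ K M) fun i => oneTmul K M (t i)).toLinearMap by
    intro x
    have : (⨆ n, filtration K M n) ≤
        LinearMap.range (aeval (R := C₂ K M) fun i => oneTmul K M (t i)).toLinearMap :=
      iSup_le fun n => filtrationLT_succ K M n ▸ key (n + 1)
    rw [iSup_filtration] at this
    exact this (Submodule.mem_top (x := x))
  intro n
  induction n with
  | zero => simp [filtrationLT]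
  | succ n ih =>
    rw [filtrationLT_succ, filtration_eq_sup]
    refine sup_le ih fun x hx => ?_
    -- The polynomial `p` represents `x` under the shuffle product, and by `proj_aeval` so does its
    -- weight `n` component. Under the full product, the value of that component differs from `x` by
    -- lower terms, which are in the range by induction.
    obtain ⟨p, hp⟩ := h (toShuffle K M x)
    have h1 := isLeadingTerm_aeval ht (weightedHomogeneousComponent_isWeightedHomogeneous n p)
    have h2 := proj_aeval ht n p
    rw [hp, LinearEquiv.symm_apply_apply, proj_of_mem hx] at h2
    have h3 := ih h1.2
    rw [← h2] at h3
    rw [← sub_sub_cancel (aeval (R := C₂ K M) (fun i => oneTmul K M (t i))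
      (weightedHomogeneousComponent w n p)) x]
    exact Submodule.sub_mem _ ⟨_, rfl⟩ h3

end GenShuffle

/-! ### Base change of generating and independent families. -/

section BaseChange

variable (A : Type*) [CommRing A] [Algebra K A] {S : Type*} [CommRing S] [Algebra K S]

/-- Via `A ⊗ K[X] ≃ A[X]`, evaluation over `A` becomes the base change of evaluation over `K`. -/
theorem aeval_one_tmul_comp_algebraTensorAlgEquiv (s : ι → S) :
    ((aeval fun i => (1 : A) ⊗ₜ[K] s i).comp (algebraTensorAlgEquiv K A).toAlgHom) =
      Algebra.TensorProduct.map (AlgHom.id A A) (aeval s) := by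
  ext i
  simp

theorem aeval_one_tmul_surjective {s : ι → S} (h : Function.Surjective (aeval (R := K) s)) :
    Function.Surjective (aeval (R := A) fun i => (1 : A) ⊗ₜ[K] s i) := by
  intro x
  induction x with
  | zero => exact ⟨0, map_zero _⟩
  | add x y hx hy =>
    obtain ⟨p, rfl⟩ := hx
    obtain ⟨q, rfl⟩ := hy
    exact ⟨p + q, map_add _ p q⟩
  | tmul a x =>
    obtain ⟨p, rfl⟩ := h x
    refine ⟨algebraTensorAlgEquiv K A (a ⊗ₜ p), ?_⟩
    exact DFunLike.congr_fun (aeval_one_tmul_comp_algebraTensorAlgEquiv (K := K) A s) (a ⊗ₜ p)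

/-- Projecting along a complement of the image gives a `K`-linear left inverse `g` of the evaluation
map. Its base change is again a left inverse, whereas bare injectivity might be lost on tensoring.
-/
theorem algebraicIndependent_one_tmul {s : ι → S} (h : AlgebraicIndependent K s)
    (hs : IsComplemented (Subalgebra.toSubmodule (Algebra.adjoin K (Set.range s)))) :
    AlgebraicIndependent A fun i => (1 : A) ⊗ₜ[K] s i := by
  obtain ⟨g, hg⟩ : ∃ g : S →ₗ[K] MvPolynomial ι K, ∀ p : MvPolynomial ι K, g (aeval s p) = p := by
    obtain ⟨N, hN⟩ := hs
    rw [Algebra.adjoin_range_eq_range_aeval] at hN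
    exact ⟨LinearMap.linearProjOfIsCompl N (aeval (R := K) s).toLinearMap
      (algebraicIndependent_iff_injective_aeval.1 h) hN,
      LinearMap.linearProjOfIsCompl_apply_left _ _ _ _⟩
  have key : ∀ z : A ⊗[K] MvPolynomial ι K,
      g.baseChange A (Algebra.TensorProduct.map (AlgHom.id A A) (aeval s) z) = z := by
    intro z
    induction z with
    | zero => simp
    | add x y hx hy => simp only [map_add, hx, hy]
    | tmul a p => simp [hg]
  rw [algebraicIndependent_iff_injective_aeval]
  refine Function.Injective.of_comp_right (g := algebraTensorAlgEquiv K A) ?_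
    (algebraTensorAlgEquiv K A).surjective
  have e : aeval (fun i => (1 : A) ⊗ₜ[K] s i) ∘ algebraTensorAlgEquiv K A =
      Algebra.TensorProduct.map (AlgHom.id A A) (aeval s) :=
    funext (DFunLike.congr_fun (aeval_one_tmul_comp_algebraTensorAlgEquiv (K := K) A s))
  rw [e]
  exact Function.LeftInverse.injective key

end BaseChange

variable (K M) in
-- Each term of a defining relation has a factor `ε(…)`, so sending all of these to zero descends to
-- an algebra map `C₂ → K`, which is a retraction of the structure map.
theorem algebraMap_C₂_injective : Function.Injective (algebraMap K (C₂ K M)) := by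
  let φ : SymM₂ K M →ₐ[K] K := SymmetricAlgebra.algebraMapInv
  have h0 : ∀ x y, φ (preEps K M x y) = 0 := fun x y => SymmetricAlgebra.algebraMapInv_ι _
  have h : ∀ x ∈ J₂ K M, φ x = 0 := by
    intro x hx
    have : J₂ K M ≤ RingHom.ker φ := by
      rw [J₂, Ideal.span_le]
      rintro _ ⟨f, g, h, -, -, -, rfl⟩
      simp [constRel, h0]
    exact this hx
  have h1 : (Ideal.Quotient.liftₐ (J₂ K M) φ h).comp (Algebra.ofId K (C₂ K M)) =
    AlgHom.id K K := Subsingleton.elim _ _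
  exact Function.LeftInverse.injective (g := Ideal.Quotient.liftₐ (J₂ K M) φ h)
    (DFunLike.congr_fun h1)

variable (K M) in
/-- `K` is a submodule of `C₂`, so it is semisimple if `C₂` is, and then each submodule of each
`K`-module has a complement. -/
theorem isComplemented_of_isSemisimpleModule_C₂ [IsSemisimpleModule K (C₂ K M)] {N : Type*}
    [AddCommGroup N] [Module K N] (P : Submodule K N) : IsComplemented P := by
  have : IsSemisimpleModule K K :=
    .of_injective (Algebra.linearMap K (C₂ K M)) (algebraMap_C₂_injective K M)
  have : IsSemisimpleRing K := this
  exact exists_isCompl P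

/-! ### Polynomial algebras after tensoring with `R ⊗ C₁`. -/

section BaseChange

variable {R C A G : Type*} [CommRing R] [CommRing C] [CommRing A] [CommRing G] [Algebra K R]
  [Algebra K C] [Algebra K A] [Algebra K G] [Algebra A G] [IsScalarTower K A G]

/-- If `G` is a polynomial algebra over `A`, then `R ⊗ C ⊗ G` is a polynomial algebra over
`R ⊗ C ⊗ A`. -/
theorem bijective_eval₂Hom_tmul {s : ι → G} (h : Function.Bijective (aeval (R := A) s)) :
    Function.Bijective (eval₂Hom
      (Algebra.TensorProduct.map (AlgHom.id K R) (Algebra.TensorProduct.map (AlgHom.id K C)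
        (IsScalarTower.toAlgHom K A G)) : R ⊗[K] (C ⊗[K] A) →+* R ⊗[K] (C ⊗[K] G))
      fun i => (1 : R) ⊗ₜ[K] ((1 : C) ⊗ₜ[K] s i)) := by
  set c : R ⊗[K] (C ⊗[K] A) →ₐ[K] R ⊗[K] (C ⊗[K] G) :=
    Algebra.TensorProduct.map (AlgHom.id K R) (Algebra.TensorProduct.map (AlgHom.id K C)
      (IsScalarTower.toAlgHom K A G))
  let eG : A ⊗[K] MvPolynomial ι K ≃ₐ[K] G :=
    ((algebraTensorAlgEquiv K A).trans (AlgEquiv.ofBijective _ h)).restrictScalars K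
  -- Reassociating moves `K[X]` next to `A`, where `A ⊗ K[X] ≃ G` by hypothesis. The rest identifies
  -- this isomorphism with evaluation.
  let e : (R ⊗[K] (C ⊗[K] A)) ⊗[K] MvPolynomial ι K ≃ₐ[K] R ⊗[K] (C ⊗[K] G) :=
    (Algebra.TensorProduct.assoc K K K R (C ⊗[K] A) (MvPolynomial ι K)).trans
      (Algebra.TensorProduct.congr AlgEquiv.refl
        ((Algebra.TensorProduct.assoc K K K C A (MvPolynomial ι K)).trans
          (Algebra.TensorProduct.congr AlgEquiv.refl eG)))
  have he : e.toAlgHom = Algebra.TensorProduct.productMap c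
      (aeval fun i => (1 : R) ⊗ₜ[K] ((1 : C) ⊗ₜ[K] s i)) := by
    ext <;> simp [e, eG, c, Algebra.TensorProduct.one_def, Algebra.algebraMap_eq_smul_one]
  have h2 : eval₂Hom (c : R ⊗[K] (C ⊗[K] A) →+* R ⊗[K] (C ⊗[K] G))
        (fun i => (1 : R) ⊗ₜ[K] ((1 : C) ⊗ₜ[K] s i)) ∘
      algebraTensorAlgEquiv K (R ⊗[K] (C ⊗[K] A)) = e := by
    funext z
    refine Eq.trans ?_ (DFunLike.congr_fun he z).symm
    simp only [Function.comp_apply]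
    induction z with
    | zero => simp
    | add x y hx hy => simp only [map_add, hx, hy]
    | tmul a p =>
      simp [smul_eq_C_mul, eval₂_map, aeval_def]
  have h3 : Function.Bijective e := e.bijective
  rw [← h2] at h3
  exact (Function.Bijective.of_comp_iff _ (algebraTensorAlgEquiv K _).bijective).1 h3

end BaseChange

/-- This replaces the coefficients `R ⊗ C₁ ⊗ C₂` by their image in `IDR`. The bijection factors as
`A[X] → T[X] → S` with surjective first map, so the second map is bijective too; injectivity of `f`
need not be checked separately. -/
theorem isAlgebraBasis_range_of_bijective {A S T : Type*} [CommRing A] [CommRing S] [CommRing T]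
    [Algebra T S] {f : A →+* T} (hf : Function.Surjective f) {s : ι → S}
    (h : Function.Bijective (eval₂Hom ((algebraMap T S).comp f) s)) :
    IsAlgebraBasis T (Set.range s) := by
  have e : (aeval (R := T) s) ∘ map f = eval₂Hom ((algebraMap T S).comp f) s := by
    funext p
    simp [aeval_def, eval₂_map]
  rw [← e] at h
  refine ⟨AlgebraicIndependent.coe_range (algebraicIndependent_iff_injective_aeval.2
    (Function.Injective.of_comp_right h.1 (map_surjective f hf))), ?_⟩
  rw [Algebra.adjoin_range_eq_range_aeval, AlgHom.range_eq_top]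
  exact Function.Surjective.of_comp h.2

end Transfer

end FreeIDR

end

/-! ### The theorem. -/

theorem mainTheorem8 {R : Type*} [CommRing R] (D : Derivation ℤ R R) (q : QuasiIntegration D) :
    -- the filtration of `(C₂ ⊗ T, +, ·)` and its associated graded algebra
    (IsRingFiltration (GenShuffle.filtration (constants D) q.RT)
        (GenShuffle.filtrationLT (constants D) q.RT) ∧
      (⨆ n, GenShuffle.filtration (constants D) q.RT n) = ⊤ ∧
      (∀ n, GenShuffle.filtration (constants D) q.RT n =
          GenShuffle.filtrationLT (constants D) q.RT n ⊔
            GenShuffle.component (constants D) q.RT n ∧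
        Disjoint (GenShuffle.filtrationLT (constants D) q.RT n)
          (GenShuffle.component (constants D) q.RT n)) ∧
      ∀ n m, ∀ x ∈ GenShuffle.component (constants D) q.RT n,
        ∀ y ∈ GenShuffle.component (constants D) q.RT m,
          GenShuffle.extShuffle (constants D) q.RT x y ∈
            GenShuffle.component (constants D) q.RT (n + m) ∧
          x * y - GenShuffle.extShuffle (constants D) q.RT x y ∈
            GenShuffle.filtrationLT (constants D) q.RT (n + m)) ∧
    -- transfer of homogeneous generating sets, algebraically independent sets and bases
    ∀ B : Set (ShuffleAlgebra (constants D) q.RT),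
      (∀ b ∈ B, ∃ n, b ∈ ShuffleAlgebra.component (constants D) q.RT n) →
      (Algebra.adjoin (constants D) B = ⊤ →
        Algebra.adjoin (C₂ (constants D) q.RT)
          (GenShuffle.oneTmul (constants D) q.RT '' B) = ⊤) ∧
      (IsSemisimpleModule (constants D) (C₂ (constants D) q.RT) ∨
          IsComplemented (Subalgebra.toSubmodule (Algebra.adjoin (constants D) B)) →
        AlgebraicIndependent (constants D) ((↑) : B → ShuffleAlgebra (constants D) q.RT) →
        AlgebraicIndependent (C₂ (constants D) q.RT)
          ((↑) : (GenShuffle.oneTmul (constants D) q.RT '' B) →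
            GenShuffle (constants D) q.RT)) ∧
      (IsAlgebraBasis (constants D) B →
        IsAlgebraBasis (IDR.coeffRing q) (IDR.oneTmul q '' B)) := by
  refine ⟨⟨GenShuffle.isRingFiltration_filtration _ _, GenShuffle.iSup_filtration _ _,
    fun n => ⟨GenShuffle.filtration_eq_sup _ _ n, GenShuffle.disjoint_filtrationLT_component _ _ n⟩,
    fun n m x hx y hy => GenShuffle.mul_sub_extShuffle_mem hx hy⟩, fun B hB => ?_⟩
  -- The weight of `b` is a degree in which it is homogeneous. It need not be unique (`b = 0`), and
  -- any choice works.
  choose! w hw using hB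
  have ht : ∀ b : B, (b : ShuffleAlgebra (constants D) q.RT) ∈
    ShuffleAlgebra.component (constants D) q.RT (w b) := fun b => hw b b.2
  have hgen : Algebra.adjoin (constants D) B = ⊤ → Function.Surjective
      (MvPolynomial.aeval (R := C₂ (constants D) q.RT)
        fun b : B => GenShuffle.oneTmul (constants D) q.RT b) := by
    intro h
    refine GenShuffle.aeval_oneTmul_surjective ht (aeval_one_tmul_surjective _ ?_)
    rw [← AlgHom.range_eq_top, ← Algebra.adjoin_range_eq_range_aeval, Subtype.range_coe, h]
  have hind : IsComplemented (Subalgebra.toSubmodule (Algebra.adjoin (constants D) B)) →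
      AlgebraicIndependent (constants D) ((↑) : B → ShuffleAlgebra (constants D) q.RT) →
      AlgebraicIndependent (C₂ (constants D) q.RT)
        fun b : B => GenShuffle.oneTmul (constants D) q.RT b := by
    intro h hi
    refine GenShuffle.algebraicIndependent_oneTmul ht (algebraicIndependent_one_tmul _ hi ?_)
    rwa [Subtype.range_coe]
  refine ⟨fun h => ?_, fun h hi => ?_, fun h => ?_⟩
  · rw [Set.image_eq_range, Algebra.adjoin_range_eq_range_aeval, AlgHom.range_eq_top]
    exact hgen h
  · rw [Set.image_eq_range]
    refine AlgebraicIndependent.coe_range (hind ?_ hi)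
    rcases h with h | h
    · exact isComplemented_of_isSemisimpleModule_C₂ _ q.RT _
    · exact h
  · rw [Set.image_eq_range]
    -- A basis generates all of `T`, which has the zero submodule as a complement, so no further
    -- assumption is needed for independence.
    have hc : IsComplemented (Subalgebra.toSubmodule (Algebra.adjoin (constants D) B)) := by
      rw [h.2, Algebra.top_toSubmodule]
      exact isComplemented_top
    exact isAlgebraBasis_range_of_bijective (f := (IDR.coeffHom q).rangeRestrict.toRingHom)
      (IDR.coeffHom q).rangeRestrict_surjective
      (bijective_eval₂Hom_tmul ⟨algebraicIndependent_iff_injective_aeval.1 (hind hc h.1), hgen h.2⟩)
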